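/- Let $A,B$ be $3\times 3$ complex matrices, and let $\mathbb{N}$ denote the set of positive integers. Then the following two conditions are equivalent: (a) there is a finite set $U\subset\mathbb{N}_{\ge 2}$ such that $\exp(tA+B)=\exp(tA)\exp(B)=\exp(B)\exp(tA)$ for every $t\in\mathbb{N}\setminus U$; (b) $e^{A+B}=e^Ae^B=e^Be^A$, and the pair $(A,B)$ has property L of Motzkin and Taussky, i.e. there are orderings $(\lambda_i)_{1\le i\le 3}$ and $(\mu_i)_{1\le i\le 3}$ of the eigenvalues of $A$ and of $B$, counted with algebraic multiplicity, such that for all $(x,y)\in\mathbb{C}^2$ the eigenvalues of $xA+yB$, counted with algebraic multiplicity, are $(x\lambda_i+y\mu_i)_{1\le i\le 3}$. -/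

import Mathlib

/-- The family of the eigenvalues of `X`, listed with their algebraic multiplicities, is `ν`:
an ordering of the `n` roots of the characteristic polynomial of `X`. -/
def IsEigenvalueOrdering {n : ℕ} (X : Matrix (Fin n) (Fin n) ℂ) (ν : Fin n → ℂ) : Prop :=
  X.charpoly.roots = (Finset.univ : Finset (Fin n)).val.map ν

/-- Property L of Motzkin and Taussky: the eigenvalues of `A` and of `B` (with multiplicities)
can be ordered as `lam` and `mu` in such a way that, for all complex numbers `x`, `y`, the
eigenvalues of `x A + y B` (with multiplicities) are the numbers `x * lam i + y * mu i`. -/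
def HasPropertyL {n : ℕ} (A B : Matrix (Fin n) (Fin n) ℂ) : Prop :=
  ∃ lam mu : Fin n → ℂ,
    IsEigenvalueOrdering A lam ∧ IsEigenvalueOrdering B mu ∧
      ∀ x y : ℂ, IsEigenvalueOrdering (x • A + y • B) (fun i => x * lam i + y * mu i)

/-! For (a) ⇒ (b), det(z - xA - yB) is a cubic form p(x, y, z) monic in z, and property L says that
it is a product of three linear forms. For large integers t the hypothesis makes each root z of p(t,
1, z) satisfy exp z = exp(t l + m) with l, m eigenvalues of A, B. If a branch of roots is tξ + δ(t)
with slowly varying δ, discreteness of the kernel of exp and the pigeonhole principle make δ repeat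
values (`exists_repeated_value`); four repetitions force a linear factor. Near a simple root of p(1,
0, z) such a branch exists; a quadratic cofactor with double leading root has a discriminant affine
in t, which must then be constant; a triple root is handled by growth, because the real parts of the
roots stay bounded. This is `HasExpRoots.isSplit`.

For (b) ⇒ (a), uniqueness of the multiplicative Jordan-Chevalley decomposition shows that the
semisimple and nilpotent parts of A + B are the sums of those of A and B, which reduces the claim to
A, B and A + B semisimple. Then B commutes with E = exp A and A with F = exp B
(`commute_exp_of_exp_add`). If E or F is not scalar, A and B commute with a non-scalar semisimple
matrix and so share a 1 + 2 block decomposition; either they commute, or E and F are scalar on the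
block of size 2. Where E = e and F = f are scalar, property L gives the eigenvalues tλ + μ of tA +
B, all with exponential e^t f, and for large t it remains to see that tA + B is diagonalizable
there: its eigenvalues are distinct, or a quadratic relation valid for A, B and A + B extends to the
pencil. -/

open Filter Topology

/-! ### Ternary cubic forms monic in one variable -/

/-- The homogeneous cubic forms in `x, y, z` that are monic in `z`, given by their coefficients. -/
structure MonicCubicForm where
  (a1 b1 a2 b2 c2 a3 b3 c3 d3 : ℂ)

namespace MonicCubicForm

/-- The value of a monic cubic form at a point. -/
def eval (p : MonicCubicForm) (x y z : ℂ) : ℂ :=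
  z ^ 3 - (p.a1 * x + p.b1 * y) * z ^ 2 + (p.a2 * x ^ 2 + p.b2 * x * y + p.c2 * y ^ 2) * z
    - (p.a3 * x ^ 3 + p.b3 * x ^ 2 * y + p.c3 * x * y ^ 2 + p.d3 * y ^ 3)

/-- A monic cubic form is split if it is a product of three linear forms. -/
def IsSplit (p : MonicCubicForm) : Prop :=
  ∃ lam mu : Fin 3 → ℂ, ∀ x y z, p.eval x y z = ∏ i, (z - (x * lam i + y * mu i))

/-- For all large integers `t`, the exponential of each root `z` of `p(t, 1, z)` is
`exp (t * l + m)` for some root `l` of `p(1, 0, z)` and some `m` in a fixed finite set. -/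
def HasExpRoots (p : MonicCubicForm) : Prop :=
  ∃ (M : Finset ℂ) (N : ℕ), ∀ t : ℕ, N ≤ t → ∀ z, p.eval t 1 z = 0 →
    ∃ l, p.eval 1 0 l = 0 ∧ ∃ m ∈ M, Complex.exp z = Complex.exp (t * l + m)

/-- The substitution `z ↦ z + l * x + m * y` in a monic cubic form. -/
def shift (p : MonicCubicForm) (l m : ℂ) : MonicCubicForm where
  a1 := p.a1 - 3 * l
  b1 := p.b1 - 3 * m
  a2 := 3 * l ^ 2 - 2 * p.a1 * l + p.a2
  b2 := 6 * l * m - 2 * p.a1 * m - 2 * p.b1 * l + p.b2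
  c2 := 3 * m ^ 2 - 2 * p.b1 * m + p.c2
  a3 := -(l ^ 3 - p.a1 * l ^ 2 + p.a2 * l - p.a3)
  b3 := -(3 * l ^ 2 * m - 2 * p.a1 * l * m - p.b1 * l ^ 2 + p.a2 * m + p.b2 * l - p.b3)
  c3 := -(3 * l * m ^ 2 - 2 * p.b1 * l * m - p.a1 * m ^ 2 + p.c2 * l + p.b2 * m - p.c3)
  d3 := -(m ^ 3 - p.b1 * m ^ 2 + p.c2 * m - p.d3)

lemma eval_shift (p : MonicCubicForm) (l m x y z : ℂ) :
    (p.shift l m).eval x y z = p.eval x y (z + (l * x + m * y)) := by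
  simp only [eval, shift]; ring

lemma HasExpRoots.shift {p : MonicCubicForm} (h : p.HasExpRoots) (l m : ℂ) :
    (p.shift l m).HasExpRoots := by
  obtain ⟨M, N, h⟩ := h
  refine ⟨M.image (fun x => x - m), N, fun t ht z hz => ?_⟩
  rw [eval_shift] at hz
  obtain ⟨l', hl', m', hm', e⟩ := h t ht _ hz
  refine ⟨l' - l, ?_, m' - m, Finset.mem_image_of_mem _ hm', ?_⟩
  · rw [eval_shift]; simpa using hl'
  · have e2 : Complex.exp (z + (l * t + m * 1) - (l * t + m))
        = Complex.exp (t * l' + m' - (l * t + m)) := by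
      rw [Complex.exp_sub, e, ← Complex.exp_sub]
    convert e2 using 2 <;> ring

lemma IsSplit.of_shift {p : MonicCubicForm} {l m : ℂ} (h : (p.shift l m).IsSplit) :
    p.IsSplit := by
  obtain ⟨lam, mu, h⟩ := h
  refine ⟨fun i => lam i + l, fun i => mu i + m, fun x y z => ?_⟩
  have := h x y (z - (l * x + m * y))
  rw [eval_shift] at this
  convert this using 2
  · ring
  · ring

end MonicCubicForm

/-! ### Elementary facts on cubics and affine functions -/

lemma exists_cubic_roots (a b c : ℂ) :
    ∃ r s t : ℂ, ∀ z, z ^ 3 - a * z ^ 2 + b * z - c = (z - r) * (z - s) * (z - t) := by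
  have hr : ∃ r : ℂ, r ^ 3 - a * r ^ 2 + b * r - c = 0 := by
    let P : Polynomial ℂ := Polynomial.X ^ 3 - Polynomial.C a * Polynomial.X ^ 2
      + Polynomial.C b * Polynomial.X - Polynomial.C c
    have hd : P.degree = 3 := by simp only [P]; compute_degree!
    obtain ⟨r, hr⟩ := IsAlgClosed.exists_root P (by rw [hd]; decide)
    exact ⟨r, by simpa [P, Polynomial.IsRoot] using hr⟩
  obtain ⟨r, hr⟩ := hr
  obtain ⟨d, hd⟩ := IsAlgClosed.exists_pow_nat_eq ((a - r) ^ 2 - 4 * (b - r * (a - r))) two_pos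
  refine ⟨r, (a - r + d) / 2, (a - r - d) / 2, fun z => ?_⟩
  linear_combination hr + (z - r) / 4 * hd

lemma cubic_coeff_unique {a b c a' b' c' : ℂ}
    (h : ∀ z : ℂ, z ^ 3 - a * z ^ 2 + b * z - c = z ^ 3 - a' * z ^ 2 + b' * z - c') :
    a = a' ∧ b = b' ∧ c = c' := by
  have h0 := h 0
  have h1 := h 1
  have h2 := h (-1)
  refine ⟨?_, ?_, ?_⟩
  · linear_combination -(1 / 2) * h1 - (1 / 2) * h2 + h0
  · linear_combination (1 / 2) * h1 - (1 / 2) * h2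
  · linear_combination - h0

lemma cubic_eq_zero_of_four_roots {a b c d : ℂ} (s : Finset ℕ) (hs : 4 ≤ s.card)
    (h : ∀ t ∈ s, a * (t : ℂ) ^ 3 + b * t ^ 2 + c * t + d = 0) :
    a = 0 ∧ b = 0 ∧ c = 0 ∧ d = 0 := by
  let P : Polynomial ℂ := Polynomial.C a * Polynomial.X ^ 3 + Polynomial.C b * Polynomial.X ^ 2
      + Polynomial.C c * Polynomial.X + Polynomial.C d
  have hd : P.natDegree ≤ 3 := by simp only [P]; compute_degree
  have hP : P = 0 := by
    refine Polynomial.eq_zero_of_natDegree_lt_card_of_eval_eq_zero' P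
      (s.image (fun n : ℕ => (n : ℂ))) ?_ ?_
    · intro z hz
      obtain ⟨t, ht, rfl⟩ := Finset.mem_image.1 hz
      simpa [P] using h t ht
    · rw [Finset.card_image_of_injective _ Nat.cast_injective]; omega
  have e := fun n => congrArg (fun q : Polynomial ℂ => q.coeff n) hP
  have e0 := e 0
  have e1 := e 1
  have e2 := e 2
  have e3 := e 3
  simp [P, Polynomial.coeff_X, Polynomial.coeff_C] at e0 e1 e2 e3
  exact ⟨e3, e2, e1, e0⟩

lemma eventually_linear_ne_zero {a : ℂ} (ha : a ≠ 0) (b : ℂ) :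
    ∀ᶠ t : ℕ in atTop, a * t + b ≠ 0 := by
  by_cases h : ∃ t0 : ℕ, a * t0 + b = 0
  · obtain ⟨t0, h0⟩ := h
    filter_upwards [eventually_gt_atTop t0] with t ht h1
    have : a * ((t : ℂ) - t0) = 0 := by linear_combination h1 - h0
    rcases mul_eq_zero.1 this with h | h
    · exact ha h
    · exact ht.ne' (by exact_mod_cast sub_eq_zero.1 h)
  · push Not at h
    exact Eventually.of_forall h

/-! ### Rigidity of exponentials along slowly varying sequences -/

/-- If exp w = 1, the solutions form the lattice 2πiℤ, which meets the unit disc only at 0;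
otherwise continuity excludes solutions near 0. -/
lemma eventually_eq_zero_of_exp_eq (w : ℂ) :
    ∀ᶠ e in 𝓝 (0 : ℂ), Complex.exp e = Complex.exp w → e = 0 := by
  by_cases hw : Complex.exp w = 1
  · have : ∀ᶠ e in 𝓝 (0 : ℂ), ‖e‖ < 1 := by
      have := Metric.ball_mem_nhds (0 : ℂ) one_pos
      filter_upwards [this] with e he
      simpa using he
    filter_upwards [this] with e he h
    rw [hw, Complex.exp_eq_one_iff] at h
    obtain ⟨n, rfl⟩ := h
    by_cases hn : n = 0
    · simp [hn]
    · exfalso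
      have h1 : (1 : ℝ) ≤ |(n : ℝ)| := by exact_mod_cast Int.one_le_abs hn
      have h2 : ‖(n : ℂ) * (2 * Real.pi * Complex.I)‖ = |(n : ℝ)| * (2 * Real.pi) := by
        simp [abs_of_pos Real.pi_pos]
      rw [h2] at he
      nlinarith [Real.pi_gt_three]
  · have : ∀ᶠ e in 𝓝 (0 : ℂ), Complex.exp e ≠ Complex.exp w :=
      Complex.continuous_exp.continuousAt.eventually_ne (by simpa using Ne.symm hw)
    filter_upwards [this] with e he h
    exact absurd h he

/-- A slowly varying sequence whose exponentials, up to a linear phase, belong to finitely many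
exponential progressions takes some value `n` times. -/
lemma exists_repeated_value (Λ M : Finset ℂ) (ξ : ℂ) (δ : ℕ → ℂ)
    (hδ : Tendsto (fun t => δ (t + 1) - δ t) atTop (𝓝 0)) (N : ℕ)
    (h : ∀ t : ℕ, N ≤ t → ∃ l ∈ Λ, ∃ m ∈ M,
      Complex.exp (t * ξ + δ t) = Complex.exp (t * l + m)) (n : ℕ) :
    ∃ (c : ℂ) (s : Finset ℕ), n ≤ s.card ∧ ∀ t ∈ s, N ≤ t ∧ δ t = c := by
  have hd : ∀ d : ℕ, Tendsto (fun t => δ (t + d) - δ t) atTop (𝓝 0) := by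
    intro d
    induction d with
    | zero => simp
    | succ d ih =>
      have h1 := (hδ.comp (tendsto_add_atTop_nat d)).add ih
      simp only [add_zero] at h1
      refine h1.congr fun t => ?_
      simp only [Function.comp_apply]
      rw [show t + (d + 1) = t + d + 1 by ring]; ring
  -- Between two times at distance d with the same pair (l, m), the increment of δ has exponential
  -- exp(d(l - ξ)). In a window of bounded length only finitely many such values occur, so small
  -- increments must vanish.
  have hev : ∀ W : ℕ, ∀ᶠ t in atTop, ∀ d ∈ Finset.range W, ∀ l ∈ Λ,
      Complex.exp (δ (t + d) - δ t) = Complex.exp (d * (l - ξ)) → δ (t + d) - δ t = 0 := by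
    intro W
    rw [Filter.eventually_all_finset]
    intro d _
    rw [Filter.eventually_all_finset]
    intro l _
    exact (hd d).eventually (eventually_eq_zero_of_exp_eq _)
  choose! lf hlf mf hmf hexp using h
  -- A window of this length has, by pigeonhole, n times sharing one pair (l, m).
  set W := (Λ ×ˢ M).card * n
  obtain ⟨t1, ht1⟩ := eventually_atTop.1 (hev W)
  set t0 := max t1 N
  obtain ⟨y, -, hy⟩ := Finset.exists_le_card_fiber_of_mul_le_card_of_maps_to
    (s := Finset.range W) (t := Λ ×ˢ M) (f := fun i => (lf (t0 + i), mf (t0 + i))) (n := n)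
    (fun i _ => Finset.mem_product.2 ⟨hlf _ (by omega), hmf _ (by omega)⟩)
    ⟨(lf t0, mf t0), Finset.mem_product.2 ⟨hlf _ (by omega), hmf _ (by omega)⟩⟩ (by simp [W])
  set S := (Finset.range W).filter (fun i => (lf (t0 + i), mf (t0 + i)) = y)
  have key : ∀ i ∈ S, ∀ j ∈ S, i ≤ j → δ (t0 + i) = δ (t0 + j) := by
    intro i hi j hj hij
    obtain ⟨d, rfl⟩ := Nat.exists_eq_add_of_le hij
    simp only [S, Finset.mem_filter, Finset.mem_range] at hi hj
    have e1 := hexp (t0 + i) (by omega)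
    have e2 := hexp (t0 + (i + d)) (by omega)
    have hyl : lf (t0 + i) = lf (t0 + (i + d)) := by
      have := hi.2.trans hj.2.symm
      exact (Prod.ext_iff.1 this).1
    have hym : mf (t0 + i) = mf (t0 + (i + d)) := by
      have := hi.2.trans hj.2.symm
      exact (Prod.ext_iff.1 this).2
    rw [hyl, hym] at e1
    have e3 := ht1 (t0 + i) (by omega) d (Finset.mem_range.2 (by omega))
      (lf (t0 + (i + d))) (hlf _ (by omega)) ?_
    · rw [show t0 + (i + d) = t0 + i + d by ring]
      exact (sub_eq_zero.1 e3).symm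
    · rw [show t0 + i + d = t0 + (i + d) by ring]
      have e4 : Complex.exp (((t0 + (i + d) : ℕ) * ξ + δ (t0 + (i + d)))
          - ((t0 + i : ℕ) * ξ + δ (t0 + i)) - d * ξ)
          = Complex.exp (((t0 + (i + d) : ℕ) * lf (t0 + (i + d)) + mf (t0 + (i + d)))
          - ((t0 + i : ℕ) * lf (t0 + (i + d)) + mf (t0 + (i + d))) - d * ξ) := by
        rw [Complex.exp_sub, Complex.exp_sub, e1, e2, ← Complex.exp_sub, ← Complex.exp_sub]
      convert e4 using 2 <;> push_cast <;> ring
  rcases S.eq_empty_or_nonempty with hS | ⟨i0, hi0⟩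
  -- An empty fiber is possible only for n = 0, so the value 0 is a dummy.
  · refine ⟨0, ∅, ?_, by simp⟩
    have : S.card = 0 := by simp [hS]
    simp only [Finset.card_empty]
    exact hy.trans this.le
  · refine ⟨δ (t0 + i0), S.image (fun i => t0 + i), ?_, ?_⟩
    · rw [Finset.card_image_of_injective _ (add_right_injective t0)]; exact hy
    · intro t ht
      obtain ⟨i, hi, rfl⟩ := Finset.mem_image.1 ht
      refine ⟨by omega, ?_⟩
      rcases le_total i i0 with h | h
      · exact key i hi i0 hi0 h
      · exact (key i0 hi0 i hi h).symm

/-! ### Linear factors and the quadratic cofactor -/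

namespace MonicCubicForm

lemma exists_finset_roots (p : MonicCubicForm) :
    ∃ Λ : Finset ℂ, ∀ l, p.eval 1 0 l = 0 → l ∈ Λ := by
  obtain ⟨r, s, t, h⟩ := exists_cubic_roots p.a1 p.a2 p.a3
  refine ⟨{r, s, t}, fun l hl => ?_⟩
  have : (l - r) * (l - s) * (l - t) = 0 := by
    rw [← h, ← hl, eval]; ring
  simp only [mul_eq_zero, sub_eq_zero] at this
  simp; tauto

/-- Repeated values of a slowly varying correction to a linear family of roots. -/
lemma HasExpRoots.exists_repeated_value {p : MonicCubicForm} (h : p.HasExpRoots) (ξ : ℂ)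
    (δ : ℕ → ℂ) (hδ : Tendsto (fun t => δ (t + 1) - δ t) atTop (𝓝 0))
    (hr : ∀ᶠ t : ℕ in atTop, p.eval t 1 (t * ξ + δ t) = 0) (n : ℕ) :
    ∃ (c : ℂ) (s : Finset ℕ), n ≤ s.card ∧
      ∀ t ∈ s, p.eval t 1 (t * ξ + δ t) = 0 ∧ δ t = c := by
  obtain ⟨M, N, h⟩ := h
  obtain ⟨N', hr⟩ := eventually_atTop.1 hr
  obtain ⟨Λ, hΛ⟩ := p.exists_finset_roots
  obtain ⟨c, s, hs, hc⟩ := _root_.exists_repeated_value Λ M ξ δ hδ (max N N') (fun t ht => by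
    obtain ⟨l, hl, m, hm, e⟩ := h t (by omega) _ (hr t (by omega))
    exact ⟨l, hΛ l hl, m, hm, e⟩) n
  exact ⟨c, s, hs, fun t ht => ⟨hr t (by have := (hc t ht).1; omega), (hc t ht).2⟩⟩

/-- For fixed c the residual p(t, 1, tξ + c) is a polynomial of degree at most 3 in t, so four times
with δ t = c annihilate it. -/
lemma HasExpRoots.exists_linear_factor {p : MonicCubicForm} (h : p.HasExpRoots) (ξ : ℂ)
    (δ : ℕ → ℂ) (hδ : Tendsto (fun t => δ (t + 1) - δ t) atTop (𝓝 0))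
    (hr : ∀ᶠ t : ℕ in atTop, p.eval t 1 (t * ξ + δ t) = 0) :
    ∃ c, ∀ t : ℂ, p.eval t 1 (t * ξ + c) = 0 := by
  obtain ⟨c, s, hs, hc⟩ := h.exists_repeated_value ξ δ hδ hr 4
  refine ⟨c, fun t => ?_⟩
  set q := p.shift ξ c
  have hq : ∀ t : ℂ, p.eval t 1 (t * ξ + c)
      = (-q.a3) * t ^ 3 + (-q.b3) * t ^ 2 + (-q.c3) * t + (-q.d3) := by
    intro t
    have := p.eval_shift ξ c t 1 0
    rw [show t * ξ + c = 0 + (ξ * t + c * 1) by ring, ← this]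
    simp only [eval, q]; ring
  obtain ⟨e1, e2, e3, e4⟩ := cubic_eq_zero_of_four_roots s hs (fun t ht => by
    rw [← hq, ← (hc t ht).2]; exact (hc t ht).1)
  rw [hq, e1, e2, e3, e4]; ring

/-- Comparing coefficients of powers of z gives polynomial identities of degree at most 3 in t; four
consecutive integers suffice to make them formal, and homogeneity restores x and y. -/
lemma isSplit_of_eventually {p : MonicCubicForm} (lam mu : Fin 3 → ℂ)
    (h : ∀ᶠ t : ℕ in atTop, ∀ z, p.eval t 1 z = ∏ i, (z - (t * lam i + mu i))) :
    p.IsSplit := by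
  obtain ⟨N, h⟩ := eventually_atTop.1 h
  have hc : ∀ t ∈ Finset.Icc N (N + 3), _ := fun t ht =>
    cubic_coeff_unique (a := p.a1 * t + p.b1) (b := p.a2 * t ^ 2 + p.b2 * t + p.c2)
      (c := p.a3 * t ^ 3 + p.b3 * t ^ 2 + p.c3 * t + p.d3)
      (a' := (t * lam 0 + mu 0) + (t * lam 1 + mu 1) + (t * lam 2 + mu 2))
      (b' := (t * lam 0 + mu 0) * (t * lam 1 + mu 1) + (t * lam 0 + mu 0) * (t * lam 2 + mu 2)
        + (t * lam 1 + mu 1) * (t * lam 2 + mu 2))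
      (c' := (t * lam 0 + mu 0) * (t * lam 1 + mu 1) * (t * lam 2 + mu 2))
      (fun z => by
        have := h t (Finset.mem_Icc.1 ht).1 z
        rw [Fin.prod_univ_three, eval] at this
        linear_combination this)
  have hs : 4 ≤ (Finset.Icc N (N + 3)).card := by simp; omega
  obtain ⟨-, -, u1, u0⟩ := cubic_eq_zero_of_four_roots (a := 0) (b := 0)
    (c := p.a1 - (lam 0 + lam 1 + lam 2)) (d := p.b1 - (mu 0 + mu 1 + mu 2)) _ hs
    (fun t ht => by linear_combination (hc t ht).1)
  obtain ⟨-, v2, v1, v0⟩ := cubic_eq_zero_of_four_roots (a := 0)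
    (b := p.a2 - (lam 0 * lam 1 + lam 0 * lam 2 + lam 1 * lam 2))
    (c := p.b2 - (lam 0 * mu 1 + mu 0 * lam 1 + lam 0 * mu 2 + mu 0 * lam 2 + lam 1 * mu 2
      + mu 1 * lam 2)) (d := p.c2 - (mu 0 * mu 1 + mu 0 * mu 2 + mu 1 * mu 2)) _ hs
    (fun t ht => by linear_combination (hc t ht).2.1)
  obtain ⟨w3, w2, w1, w0⟩ := cubic_eq_zero_of_four_roots
    (a := p.a3 - lam 0 * lam 1 * lam 2)
    (b := p.b3 - (mu 0 * lam 1 * lam 2 + lam 0 * mu 1 * lam 2 + lam 0 * lam 1 * mu 2))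
    (c := p.c3 - (lam 0 * mu 1 * mu 2 + mu 0 * lam 1 * mu 2 + mu 0 * mu 1 * lam 2))
    (d := p.d3 - mu 0 * mu 1 * mu 2) _ hs
    (fun t ht => by linear_combination (hc t ht).2.2)
  refine ⟨lam, mu, fun x y z => ?_⟩
  rw [Fin.prod_univ_three, eval]
  linear_combination (-z ^ 2 * x) * u1 - z ^ 2 * y * u0 + z * x ^ 2 * v2 + z * x * y * v1
    + z * y ^ 2 * v0 - x ^ 3 * w3 - x ^ 2 * y * w2 - x * y ^ 2 * w1 - y ^ 3 * w0

lemma isSplit_of_two_linear_factors {p : MonicCubicForm} {ξ η c d : ℂ} (hne : ξ ≠ η)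
    (h1 : ∀ t : ℂ, p.eval t 1 (t * ξ + c) = 0) (h2 : ∀ t : ℂ, p.eval t 1 (t * η + d) = 0) :
    p.IsSplit := by
  -- The third factor is dictated by the sum of the roots, a1 t + b1.
  refine isSplit_of_eventually ![ξ, η, p.a1 - ξ - η] ![c, d, p.b1 - c - d] ?_
  filter_upwards [eventually_linear_ne_zero (sub_ne_zero.2 hne) (c - d)] with t ht z
  have e1 := h1 t
  have e2 := h2 t
  simp only [Fin.prod_univ_three, Matrix.cons_val_zero, Matrix.cons_val_one, Matrix.cons_val]
  -- Multiplying by the difference of the two known roots, nonzero for large t, turns the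
  -- factorization into a combination of the two root equations.
  refine mul_left_cancel₀ ht ?_
  rw [eval] at *
  linear_combination (z - (t * η + d)) * e1 - (z - (t * ξ + c)) * e2

/-- Choose the sign of each new root d' so that ‖d' + d‖ ≥ ‖d‖. Since (d' - d)(d' + d) = β, the step
is at most ‖β‖ / ‖d‖, which tends to 0. -/
lemma exists_slow_sqrt {β : ℂ} (hβ : β ≠ 0) (γ : ℂ) :
    ∃ d : ℕ → ℂ, (∀ t, d t ^ 2 = β * t + γ) ∧
      Tendsto (fun t => d (t + 1) - d t) atTop (𝓝 0) := by
  have hstep : ∀ (t : ℕ) (w : ℂ), ∃ w' : ℂ, w' ^ 2 = β * (t + 1 : ℕ) + γ ∧ ‖w‖ ≤ ‖w' + w‖ := by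
    intro t w
    obtain ⟨r, hr⟩ := IsAlgClosed.exists_pow_nat_eq (β * (t + 1 : ℕ) + γ) two_pos
    by_cases h : ‖w‖ ≤ ‖r + w‖
    · exact ⟨r, hr, h⟩
    · refine ⟨-r, by rw [neg_sq, hr], ?_⟩
      have : ‖(r + w) + (-r + w)‖ ≤ ‖r + w‖ + ‖-r + w‖ := norm_add_le _ _
      rw [show (r + w) + (-r + w) = 2 * w by ring, norm_mul] at this
      simp only [Complex.norm_ofNat] at this
      push Not at h
      linarith
  choose f hf1 hf2 using hstep
  obtain ⟨d0, hd0⟩ := IsAlgClosed.exists_pow_nat_eq γ two_pos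
  let d : ℕ → ℂ := fun t => Nat.rec d0 f t
  have hd : ∀ t, d t ^ 2 = β * t + γ := by
    intro t
    cases t with
    | zero => simp [d, hd0]
    | succ t => exact hf1 t (d t)
  refine ⟨d, hd, ?_⟩
  have hinf : Tendsto (fun t => ‖d t‖) atTop atTop := by
    have h1 : Tendsto (fun t : ℕ => ‖β‖ * (t : ℝ) - ‖γ‖) atTop atTop :=
      tendsto_atTop_add_const_right _ _
        (tendsto_natCast_atTop_atTop.const_mul_atTop (norm_pos_iff.2 hβ))
    have h2 : Tendsto (fun t : ℕ => ‖d t‖ ^ 2) atTop atTop := by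
      refine tendsto_atTop_mono (fun t => ?_) h1
      rw [← norm_pow, hd]
      have := norm_sub_norm_le (β * t) (-γ)
      simpa using this
    have h3 := Real.tendsto_sqrt_atTop.comp h2
    refine h3.congr fun t => ?_
    simp
  have hz : Tendsto (fun t => ‖β‖ * ‖d t‖⁻¹) atTop (𝓝 0) := by
    simpa using hinf.inv_tendsto_atTop.const_mul ‖β‖
  refine squeeze_zero_norm' ?_ hz
  filter_upwards [hinf.eventually_gt_atTop 0] with t ht
  have e : (d (t + 1) - d t) * (d (t + 1) + d t) = β := by
    have h1 := hd (t + 1)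
    have h2 := hd t
    push_cast at h1
    linear_combination h1 - h2
  have e2 : ‖d t‖ ≤ ‖d (t + 1) + d t‖ := hf2 t (d t)
  have e3 : ‖d (t + 1) - d t‖ * ‖d (t + 1) + d t‖ = ‖β‖ := by rw [← norm_mul, e]
  rw [← div_eq_mul_inv, le_div_iff₀ ht]
  calc ‖d (t + 1) - d t‖ * ‖d t‖ ≤ ‖d (t + 1) - d t‖ * ‖d (t + 1) + d t‖ := by gcongr
    _ = ‖β‖ := e3

/-- A linear factor splits the form when the other two roots of `p(1, 0, z)` coincide. -/
lemma HasExpRoots.isSplit_of_linear_factor {p : MonicCubicForm} (h : p.HasExpRoots) {ξ η c : ℂ}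
    (hc : ∀ t : ℂ, p.eval t 1 (t * ξ + c) = 0) (h1 : p.a1 = ξ + 2 * η)
    (h2 : p.a2 = 2 * ξ * η + η ^ 2) : p.IsSplit := by
  -- The quadratic left after dividing by the linear factor has discriminant βt + γ: its t² term
  -- cancels because the leading roots both equal η.
  set β := 4 * η * (p.b1 - c) - 4 * (p.b2 - ξ * (p.b1 - c) - 2 * c * η) with hβ
  set γ := (p.b1 - c) ^ 2 - 4 * (p.c2 - c * (p.b1 - c)) with hγ
  have hfac : ∀ t z d : ℂ, d ^ 2 = β * t + γ → p.eval t 1 z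
      = (z - (t * ξ + c)) * (z - (t * η + (p.b1 - c + d) / 2))
        * (z - (t * η + (p.b1 - c - d) / 2)) := by
    intro t z d hd
    have := hc t
    rw [hβ, hγ] at hd
    rw [eval] at *
    rw [h1, h2] at *
    linear_combination this + (z - (t * ξ + c)) / 4 * hd
  by_cases hβ0 : β = 0
  · obtain ⟨d, hd⟩ := IsAlgClosed.exists_pow_nat_eq γ two_pos
    refine isSplit_of_eventually ![ξ, η, η] ![c, (p.b1 - c + d) / 2, (p.b1 - c - d) / 2]
      (Eventually.of_forall fun t z => ?_)
    rw [hfac t z d (by rw [hd, hβ0]; ring)]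
    simp [Fin.prod_univ_three]
  · exfalso
    -- A repeated value of d contradicts the injectivity of t ↦ βt + γ = d(t)².
    obtain ⟨d, hd, hdt⟩ := exists_slow_sqrt hβ0 γ
    obtain ⟨w, s, hs, hw⟩ := h.exists_repeated_value η (fun t => (p.b1 - c + d t) / 2) (by
      have := hdt.div_const 2
      simp only [zero_div] at this
      refine this.congr fun t => ?_
      ring) (Eventually.of_forall fun t => by rw [hfac t _ (d t) (hd t)]; ring) 2
    obtain ⟨t, ht, t', ht', hne⟩ := Finset.one_lt_card.1 (by omega : 1 < s.card)
    have e := (hw t ht).2.trans (hw t' ht').2.symm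
    have e1 : d t = d t' := by linear_combination 2 * e
    have e2 := hd t
    rw [e1, hd t'] at e2
    have e3 : β * ((t : ℂ) - t') = 0 := by linear_combination -e2
    rcases mul_eq_zero.1 e3 with h | h
    · exact hβ0 h
    · exact hne (by exact_mod_cast sub_eq_zero.1 h)

/-- Take the root nearest to c. The z-derivative at c is the sum of the three pairwise products of
the differences root - c; multiplied by the smallest difference, each product is at most ‖p(t, 1,
c)‖ in norm. -/
lemma exists_root_near (p : MonicCubicForm) (t c : ℂ) : ∃ r, p.eval t 1 r = 0 ∧
    ‖r - c‖ * ‖3 * c ^ 2 - 2 * (p.a1 * t + p.b1) * c + (p.a2 * t ^ 2 + p.b2 * t + p.c2)‖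
      ≤ 3 * ‖p.eval t 1 c‖ := by
  obtain ⟨r, s, u, h⟩ := exists_cubic_roots (p.a1 * t + p.b1) (p.a2 * t ^ 2 + p.b2 * t + p.c2)
    (p.a3 * t ^ 3 + p.b3 * t ^ 2 + p.c3 * t + p.d3)
  have he : ∀ z, p.eval t 1 z = (z - r) * (z - s) * (z - u) := fun z => by
    rw [← h, eval]; ring
  obtain ⟨k1, k2, -⟩ := cubic_coeff_unique (a' := r + s + u) (b' := r * s + r * u + s * u)
    (c' := r * s * u) (fun z => by rw [h z]; ring)
  have hd : 3 * c ^ 2 - 2 * (p.a1 * t + p.b1) * c + (p.a2 * t ^ 2 + p.b2 * t + p.c2)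
      = (r - c) * (s - c) + (r - c) * (u - c) + (s - c) * (u - c) := by
    rw [k1, k2]; ring
  have key : ∀ a b d : ℂ, ‖a‖ ≤ ‖b‖ → ‖a‖ ≤ ‖d‖ →
      ‖a‖ * ‖a * b + a * d + b * d‖ ≤ 3 * (‖a‖ * ‖b‖ * ‖d‖) := by
    intro a b d hab had
    have h3 : ‖a * b + a * d + b * d‖ ≤ ‖a‖ * ‖b‖ + ‖a‖ * ‖d‖ + ‖b‖ * ‖d‖ := by
      simpa using norm_add₃_le (a := a * b) (b := a * d) (c := b * d)
    have h1 : ‖a‖ * ‖b‖ ≤ ‖d‖ * ‖b‖ := by gcongr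
    have h2 : ‖a‖ * ‖d‖ ≤ ‖b‖ * ‖d‖ := by gcongr
    nlinarith [norm_nonneg a]
  have hn : ‖p.eval t 1 c‖ = ‖r - c‖ * ‖s - c‖ * ‖u - c‖ := by
    rw [he, norm_mul, norm_mul, norm_sub_rev c, norm_sub_rev c, norm_sub_rev c]
  rw [hd, hn]
  by_cases h1 : ‖r - c‖ ≤ ‖s - c‖ ∧ ‖r - c‖ ≤ ‖u - c‖
  · exact ⟨r, by rw [he]; ring, key _ _ _ h1.1 h1.2⟩
  by_cases h2 : ‖s - c‖ ≤ ‖r - c‖ ∧ ‖s - c‖ ≤ ‖u - c‖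
  · refine ⟨s, by rw [he]; ring, ?_⟩
    convert key _ _ _ h2.1 h2.2 using 2
    · congr 1; ring
    · ring
  · have h3 : ‖u - c‖ ≤ ‖r - c‖ ∧ ‖u - c‖ ≤ ‖s - c‖ := by
      constructor <;> by_contra hh <;> push Not at h1 h2 hh <;>
        by_cases h5 : ‖r - c‖ ≤ ‖s - c‖ <;> first | linarith [h1 h5] | skip
      all_goals push Not at h5; linarith [h2 h5.le]
    refine ⟨u, by rw [he]; ring, ?_⟩
    convert key _ _ _ h3.1 h3.2 using 2
    · congr 1; ring
    · ring

/-- Approximate linear families of simple roots are close to exact ones. -/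
lemma HasExpRoots.exists_constant_factor {p : MonicCubicForm} (h : p.HasExpRoots) (c L : ℂ)
    (hL : L ≠ 0) (k : ℕ) (h1 : Tendsto (fun t : ℕ => p.eval t 1 c / (t : ℂ) ^ k) atTop (𝓝 0))
    (h2 : Tendsto (fun t : ℕ => (3 * c ^ 2 - 2 * (p.a1 * t + p.b1) * c
      + (p.a2 * t ^ 2 + p.b2 * t + p.c2)) / (t : ℂ) ^ k) atTop (𝓝 L)) :
    ∃ c, ∀ t : ℂ, p.eval t 1 c = 0 := by
  choose! δ hδ hδ' using fun t : ℂ => p.exists_root_near t c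
  -- The distance is at most three times the ratio of value to derivative; the common scale t^k
  -- cancels, leaving o(1).
  have hlim : Tendsto (fun t : ℕ => δ t - c) atTop (𝓝 0) := by
    have h3 : Tendsto (fun t : ℕ => 3 * ‖p.eval t 1 c / (t : ℂ) ^ k‖ / (‖L‖ / 2)) atTop (𝓝 0) := by
      simpa using (h1.norm.const_mul 3).div_const (‖L‖ / 2)
    refine squeeze_zero_norm' ?_ h3
    have hL' : ‖L‖ / 2 < ‖L‖ := by linarith [norm_pos_iff.2 hL]
    filter_upwards [h2.norm.eventually_const_le hL', eventually_gt_atTop 0] with t ht ht0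
    have hLp := norm_pos_iff.2 hL
    rw [le_div_iff₀ (by positivity)]
    have htp : 0 < ‖(t : ℂ) ^ k‖ := by
      rw [norm_pos_iff]; exact pow_ne_zero _ (by exact_mod_cast ht0.ne')
    rw [norm_div, le_div_iff₀ htp] at ht
    rw [norm_div, ← mul_div_assoc 3, le_div_iff₀ htp, mul_assoc]
    exact (mul_le_mul_of_nonneg_left ht (norm_nonneg _)).trans (hδ' t)
  obtain ⟨d, hd⟩ := h.exists_linear_factor 0 (fun t => δ t) (by
    have := (hlim.comp (tendsto_add_atTop_nat 1)).sub hlim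
    simpa using this) (Eventually.of_forall fun t => by simpa using hδ t)
  exact ⟨d, fun t => by simpa using hd t⟩

end MonicCubicForm

/-! ### Growth estimates -/

lemma tendsto_poly_div_natCast_sq (a b c : ℂ) :
    Tendsto (fun t : ℕ => (a * t ^ 2 + b * t + c) / (t : ℂ) ^ 2) atTop (𝓝 a) := by
  have hinv : Tendsto (fun t : ℕ => ((t : ℂ))⁻¹) atTop (𝓝 0) := tendsto_inv_atTop_nhds_zero_nat
  have h : Tendsto (fun t : ℕ => a + b * (t : ℂ)⁻¹ + c * ((t : ℂ)⁻¹ * (t : ℂ)⁻¹)) atTop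
      (𝓝 (a + b * 0 + c * (0 * 0))) :=
    (tendsto_const_nhds.add (hinv.const_mul b)).add ((hinv.mul hinv).const_mul c)
  simp only [mul_zero, add_zero] at h
  refine h.congr' ?_
  filter_upwards [eventually_gt_atTop 0] with t ht
  have : (t : ℂ) ≠ 0 := by exact_mod_cast ht.ne'
  field_simp

lemma tendsto_poly_div_natCast (a b : ℂ) :
    Tendsto (fun t : ℕ => (a * t + b) / (t : ℂ) ^ 1) atTop (𝓝 a) := by
  have hinv : Tendsto (fun t : ℕ => ((t : ℂ))⁻¹) atTop (𝓝 0) := tendsto_inv_atTop_nhds_zero_nat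
  have h : Tendsto (fun t : ℕ => a + b * (t : ℂ)⁻¹) atTop (𝓝 (a + b * 0)) :=
    tendsto_const_nhds.add (hinv.const_mul b)
  simp only [mul_zero, add_zero] at h
  refine h.congr' ?_
  filter_upwards [eventually_gt_atTop 0] with t ht
  have : (t : ℂ) ≠ 0 := by exact_mod_cast ht.ne'
  field_simp

/-- A quadratic whose square is bounded by a cubic has no quadratic term. -/
lemma leadingCoeff_eq_zero_of_norm_sq_le_cubic {a b c : ℂ} {K L : ℝ}
    (h : ∀ᶠ t : ℕ in atTop, ‖a * t ^ 2 + b * t + c‖ ^ 2 ≤ (K + L * t) ^ 3) : a = 0 := by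
  have h1 : Tendsto (fun t : ℕ => ‖(a * t ^ 2 + b * t + c) / (t : ℂ) ^ 2‖ ^ 2) atTop
      (𝓝 (‖a‖ ^ 2)) := (tendsto_poly_div_natCast_sq a b c).norm.pow 2
  have hinv : Tendsto (fun t : ℕ => ((t : ℝ))⁻¹) atTop (𝓝 0) := tendsto_inv_atTop_nhds_zero_nat
  have h2 : Tendsto (fun t : ℕ => (K * (t : ℝ)⁻¹ + L) ^ 3 * (t : ℝ)⁻¹) atTop
      (𝓝 ((K * 0 + L) ^ 3 * 0)) :=
    (((hinv.const_mul K).add tendsto_const_nhds).pow 3).mul hinv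
  rw [mul_zero] at h2
  have h3 : ‖a‖ ^ 2 ≤ 0 := by
    refine le_of_tendsto_of_tendsto h1 h2 ?_
    filter_upwards [h, eventually_gt_atTop 0] with t ht ht0
    have ht' : (0 : ℝ) < t := by exact_mod_cast ht0
    rw [norm_div, norm_pow, Complex.norm_natCast, div_pow, div_le_iff₀ (by positivity)]
    refine ht.trans (le_of_eq ?_)
    field_simp
  simpa using pow_eq_zero_iff (two_ne_zero) |>.1 (le_antisymm h3 (by positivity))

/-- A bounded linear function is constant. -/
lemma slope_eq_zero_of_norm_sq_le {a b : ℂ} {K : ℝ}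
    (h : ∀ᶠ t : ℕ in atTop, ‖a * t + b‖ ^ 2 ≤ K) : a = 0 := by
  have h1 : Tendsto (fun t : ℕ => ‖(a * t + b) / (t : ℂ) ^ 1‖ ^ 2) atTop
      (𝓝 (‖a‖ ^ 2)) := (tendsto_poly_div_natCast a b).norm.pow 2
  have hinv : Tendsto (fun t : ℕ => ((t : ℝ))⁻¹) atTop (𝓝 0) := tendsto_inv_atTop_nhds_zero_nat
  have h2 : Tendsto (fun t : ℕ => K * ((t : ℝ)⁻¹) ^ 2) atTop (𝓝 (K * 0 ^ 2)) :=
    (hinv.pow 2).const_mul K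
  have h3 : ‖a‖ ^ 2 ≤ 0 := by
    refine (le_of_tendsto_of_tendsto h1 h2 ?_).trans (by simp)
    filter_upwards [h, eventually_gt_atTop 0] with t ht ht0
    have ht' : (0 : ℝ) < t := by exact_mod_cast ht0
    rw [norm_div, norm_pow, Complex.norm_natCast, div_pow, div_le_iff₀ (by positivity)]
    refine ht.trans (le_of_eq ?_)
    field_simp
  simpa using pow_eq_zero_iff (two_ne_zero) |>.1 (le_antisymm h3 (by positivity))

/-- Three numbers with bounded real parts are controlled by the sum of their squares. -/
lemma norm_sq_le_of_abs_re_le {r s u σ : ℂ} {R : ℝ} (hr : |r.re| ≤ R) (hs : |s.re| ≤ R)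
    (hu : |u.re| ≤ R) (h : r ^ 2 + s ^ 2 + u ^ 2 = -2 * σ) :
    ‖r‖ ^ 2 ≤ 4 * R ^ 2 + 2 * ‖σ‖ ∧ ‖s‖ ^ 2 ≤ 4 * R ^ 2 + 2 * ‖σ‖ ∧
      ‖u‖ ^ 2 ≤ 4 * R ^ 2 + 2 * ‖σ‖ := by
  -- The real part expresses the sum of the squared imaginary parts as the sum of the squared real
  -- parts plus 2 Re σ, hence at most 3R² + 2‖σ‖.
  have h1 := congrArg Complex.re h
  have h2 : |σ.re| ≤ ‖σ‖ := Complex.abs_re_le_norm σ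
  have h3 := (abs_le.1 h2).2
  simp [pow_two] at h1
  have hr2 : r.re ^ 2 ≤ R ^ 2 := sq_le_sq' (abs_le.1 hr).1 (abs_le.1 hr).2
  have hs2 : s.re ^ 2 ≤ R ^ 2 := sq_le_sq' (abs_le.1 hs).1 (abs_le.1 hs).2
  have hu2 : u.re ^ 2 ≤ R ^ 2 := sq_le_sq' (abs_le.1 hu).1 (abs_le.1 hu).2
  simp only [Complex.sq_norm, Complex.normSq_apply]
  refine ⟨?_, ?_, ?_⟩ <;>
    nlinarith [mul_self_nonneg r.im, mul_self_nonneg s.im, mul_self_nonneg u.im]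

/-! ### Splitting by the multiplicities of the leading roots -/

namespace MonicCubicForm

/-- All l are 0, so the real parts of the roots are bounded. Their sum is 0 and their squares add up
to -2(b2 t + c2), so they are O(√t) and their product is O(t^(3/2)): b3 = 0. If b2 = 0 the roots are
bounded and c3 = 0 as well; otherwise c3 / b2 is an asymptotic root, which yields a linear factor.
-/
lemma HasExpRoots.isSplit_of_triple_root {p : MonicCubicForm} (h : p.HasExpRoots)
    (ha1 : p.a1 = 0) (ha2 : p.a2 = 0) (ha3 : p.a3 = 0) (hb1 : p.b1 = 0) : p.IsSplit := by
  have hre : ∃ R : ℝ, ∀ᶠ t : ℕ in atTop, ∀ z, p.eval t 1 z = 0 → |z.re| ≤ R := by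
    obtain ⟨M, N, hM⟩ := h
    refine ⟨∑ m ∈ M, |m.re|, eventually_atTop.2 ⟨N, fun t ht z hz => ?_⟩⟩
    obtain ⟨l, hl, m, hm, e⟩ := hM t ht z hz
    have hl0 : l = 0 := by
      simp only [eval, ha1, ha2, ha3] at hl
      simpa using hl
    rw [hl0, mul_zero, zero_add] at e
    have e2 := congrArg (fun w => ‖w‖) e
    simp only [Complex.norm_exp, Real.exp_eq_exp] at e2
    rw [e2]
    exact Finset.single_le_sum (f := fun m : ℂ => |m.re|) (fun _ _ => abs_nonneg _) hm
  obtain ⟨R, hR⟩ := hre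
  have hbound : ∀ᶠ t : ℕ in atTop, ‖p.b3 * t ^ 2 + p.c3 * t + p.d3‖ ^ 2 ≤
      (4 * R ^ 2 + 2 * ‖p.b2 * t + p.c2‖) ^ 3 := by
    filter_upwards [hR] with t ht
    obtain ⟨r, s, u, hru⟩ := exists_cubic_roots 0 (p.b2 * t + p.c2)
      (p.b3 * t ^ 2 + p.c3 * t + p.d3)
    have he : ∀ z, p.eval t 1 z = (z - r) * (z - s) * (z - u) := fun z => by
      rw [← hru, eval, ha1, ha2, ha3, hb1]; ring
    obtain ⟨k1, k2, k3⟩ := cubic_coeff_unique (a' := r + s + u) (b' := r * s + r * u + s * u)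
      (c' := r * s * u) (fun z => by rw [hru z]; ring)
    obtain ⟨n1, n2, n3⟩ := norm_sq_le_of_abs_re_le (σ := p.b2 * t + p.c2)
      (ht r (by rw [he]; ring)) (ht s (by rw [he]; ring)) (ht u (by rw [he]; ring)) (by
        rw [k2]; linear_combination -(r + s + u) * k1)
    rw [k3, norm_mul, norm_mul, mul_pow, mul_pow, pow_three']
    gcongr
  have hb3 : p.b3 = 0 := by
    refine leadingCoeff_eq_zero_of_norm_sq_le_cubic (b := p.c3) (c := p.d3)
      (K := 4 * R ^ 2 + 2 * ‖p.c2‖) (L := 2 * ‖p.b2‖) ?_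
    filter_upwards [hbound] with t ht
    refine ht.trans (pow_le_pow_left₀ (by positivity) ?_ 3)
    have := norm_add_le (p.b2 * t) p.c2
    rw [norm_mul, Complex.norm_natCast] at this
    linarith
  by_cases hb2 : p.b2 = 0
  · have hc3 : p.c3 = 0 := by
      refine slope_eq_zero_of_norm_sq_le (b := p.d3) (K := (4 * R ^ 2 + 2 * ‖p.c2‖) ^ 3) ?_
      filter_upwards [hbound] with t ht
      simpa [hb2, hb3] using ht
    obtain ⟨r, s, u, hru⟩ := exists_cubic_roots 0 p.c2 p.d3
    refine isSplit_of_eventually 0 ![r, s, u] (Eventually.of_forall fun t z => ?_)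
    rw [eval, ha1, ha2, ha3, hb1, hb2, hb3, hc3]
    simp only [Fin.prod_univ_three, Matrix.cons_val_zero, Matrix.cons_val_one, Matrix.cons_val,
      Pi.zero_apply]
    linear_combination hru z
  · obtain ⟨c, hc⟩ := h.exists_constant_factor (p.c3 / p.b2) p.b2 hb2 1
      (by
        have := tendsto_poly_div_natCast 0 ((p.c3 / p.b2) ^ 3 + p.c2 * (p.c3 / p.b2) - p.d3)
        refine this.congr fun t => ?_
        congr 1
        rw [eval, ha1, ha2, ha3, hb1, hb3]
        field_simp
        ring)
      (by
        have := tendsto_poly_div_natCast p.b2 (3 * (p.c3 / p.b2) ^ 2 + p.c2)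
        refine this.congr fun t => ?_
        congr 1
        rw [ha1, ha2, hb1]
        ring)
    exact h.isSplit_of_linear_factor (ξ := 0) (η := 0) (c := c)
      (fun t => by simpa using hc t) (by simp [ha1]) (by simp [ha2])

/-- A simple root of `p(1, 0, z)` is the slope of a linear factor. -/
lemma HasExpRoots.exists_linear_factor_of_simple_root {p : MonicCubicForm} (h : p.HasExpRoots)
    {l m n : ℂ} (hp : ∀ z, p.eval 1 0 z = (z - l) * (z - m) * (z - n)) (hm : l ≠ m)
    (hn : l ≠ n) : ∃ c, ∀ t : ℂ, p.eval t 1 (t * l + c) = 0 := by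
  set q := p.shift l 0 with hq
  have hqr : q.HasExpRoots := h.shift l 0
  obtain ⟨-, k2, k3⟩ := cubic_coeff_unique (a := q.a1) (b := q.a2) (c := q.a3)
    (a' := (m - l) + (n - l)) (b' := (m - l) * (n - l)) (c' := 0) (fun z => by
      have e1 := p.eval_shift l 0 1 0 z
      have e2 := hp (z + (l * 1 + 0 * 0))
      rw [← e1, ← hq, eval] at e2
      linear_combination e2)
  have ha2 : q.a2 ≠ 0 := by
    rw [k2]; exact mul_ne_zero (sub_ne_zero.2 hm.symm) (sub_ne_zero.2 hn.symm)
  -- After the shift a3 = 0, so the leading term of q(t, 1, z) is t²(a2 z - b3) and its derivative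
  -- in z grows like a2 t².
  set c := q.b3 / q.a2
  have hc : q.a2 * c = q.b3 := by simp only [c]; field_simp
  obtain ⟨d, hd⟩ := hqr.exists_constant_factor c q.a2 ha2 2
    (by
      have := tendsto_poly_div_natCast_sq 0 (-q.a1 * c ^ 2 + q.b2 * c - q.c3)
        (c ^ 3 - q.b1 * c ^ 2 + q.c2 * c - q.d3)
      refine this.congr fun t => ?_
      congr 1
      rw [eval, k3]
      linear_combination (-(t : ℂ) ^ 2) * hc)
    (by
      have := tendsto_poly_div_natCast_sq q.a2 (-2 * q.a1 * c + q.b2)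
        (3 * c ^ 2 - 2 * q.b1 * c + q.c2)
      refine this.congr fun t => ?_
      congr 1
      ring)
  refine ⟨d, fun t => ?_⟩
  have := hd t
  rw [hq, eval_shift] at this
  rw [← this]; congr 1; ring

lemma HasExpRoots.isSplit_of_simple_root {p : MonicCubicForm} (h : p.HasExpRoots)
    {l m n : ℂ} (hp : ∀ z, p.eval 1 0 z = (z - l) * (z - m) * (z - n)) (hm : l ≠ m)
    (hn : l ≠ n) : p.IsSplit := by
  obtain ⟨c, hc⟩ := h.exists_linear_factor_of_simple_root hp hm hn
  by_cases hmn : m = n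
  · subst hmn
    obtain ⟨k1, k2, -⟩ := cubic_coeff_unique (a := p.a1) (b := p.a2) (c := p.a3)
      (a' := l + m + m) (b' := l * m + l * m + m * m) (c' := l * m * m) (fun z => by
        have := hp z
        rw [eval] at this
        linear_combination this)
    exact h.isSplit_of_linear_factor hc (η := m) (by rw [k1]; ring) (by rw [k2]; ring)
  · obtain ⟨d, hd⟩ := h.exists_linear_factor_of_simple_root (l := m) (m := l) (n := n)
      (fun z => by rw [hp]; ring) hm.symm hmn
    exact isSplit_of_two_linear_factors hm hc hd

theorem HasExpRoots.isSplit {p : MonicCubicForm} (h : p.HasExpRoots) : p.IsSplit := by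
  obtain ⟨l, m, n, hlmn⟩ := exists_cubic_roots p.a1 p.a2 p.a3
  have hp : ∀ z, p.eval 1 0 z = (z - l) * (z - m) * (z - n) := fun z => by
    rw [← hlmn, eval]; ring
  by_cases h1 : l = m
  · by_cases h2 : l = n
    · subst h1 h2
      obtain ⟨k1, k2, k3⟩ := cubic_coeff_unique (a' := l + l + l) (b' := l * l + l * l + l * l)
        (c' := l * l * l) (fun z => by rw [hlmn z]; ring)
      -- Moving the triple root to 0 clears the pure powers of x; the shift by b1 / 3 makes the sum
      -- of the roots vanish too.
      refine IsSplit.of_shift (l := l) (m := p.b1 / 3)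
        ((h.shift l (p.b1 / 3)).isSplit_of_triple_root ?_ ?_ ?_ ?_)
      · simp only [MonicCubicForm.shift]; rw [k1]; ring
      · simp only [MonicCubicForm.shift]; rw [k1, k2]; ring
      · simp only [MonicCubicForm.shift]; rw [k1, k2, k3]; ring
      · simp only [MonicCubicForm.shift]; ring
    · exact h.isSplit_of_simple_root (l := n) (m := l) (n := m) (fun z => by rw [hp]; ring)
        (Ne.symm h2) (h1 ▸ Ne.symm h2)
  · by_cases h2 : l = n
    · exact h.isSplit_of_simple_root (l := m) (m := l) (n := n) (fun z => by rw [hp]; ring)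
        (Ne.symm h1) (h2 ▸ Ne.symm h1)
    · exact h.isSplit_of_simple_root hp h1 h2

end MonicCubicForm

/-! ### Characteristic polynomials of matrix pencils -/

lemma isEigenvalueOrdering_iff {n : ℕ} (X : Matrix (Fin n) (Fin n) ℂ) (ν : Fin n → ℂ) :
    IsEigenvalueOrdering X ν ↔ ∀ z, (Matrix.scalar (Fin n) z - X).det = ∏ i, (z - ν i) := by
  have h1 : X.charpoly = (X.charpoly.roots.map fun a => Polynomial.X - Polynomial.C a).prod :=
    ((IsAlgClosed.splits X.charpoly).eq_prod_roots_of_monic X.charpoly_monic)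
  constructor
  · intro h z
    rw [← Matrix.eval_charpoly, h1, h, Multiset.map_map, Polynomial.eval_multiset_prod,
      Multiset.map_map]
    simp [List.prod_ofFn]
  · intro h
    have h2 : X.charpoly = ∏ i, (Polynomial.X - Polynomial.C (ν i)) := by
      refine Polynomial.funext fun z => ?_
      rw [Matrix.eval_charpoly, h, Polynomial.eval_prod]
      simp
    rw [IsEigenvalueOrdering, h2]
    have := Polynomial.roots_multiset_prod_X_sub_C ((Finset.univ : Finset (Fin n)).val.map ν)
    rw [Multiset.map_map] at this
    exact this

lemma hasPropertyL_iff {n : ℕ} (A B : Matrix (Fin n) (Fin n) ℂ) :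
    HasPropertyL A B ↔ ∃ lam mu : Fin n → ℂ, ∀ x y z,
      (Matrix.scalar (Fin n) z - (x • A + y • B)).det = ∏ i, (z - (x * lam i + y * mu i)) := by
  constructor
  · rintro ⟨lam, mu, -, -, h⟩
    exact ⟨lam, mu, fun x y => (isEigenvalueOrdering_iff _ _).1 (h x y)⟩
  · rintro ⟨lam, mu, h⟩
    have h' := fun x y => (isEigenvalueOrdering_iff _ _).2 (h x y)
    exact ⟨lam, mu, by simpa using h' 1 0, by simpa using h' 0 1, h'⟩

lemma exists_monicCubicForm_eq_det (A B : Matrix (Fin 3) (Fin 3) ℂ) :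
    ∃ p : MonicCubicForm, ∀ x y z,
      (Matrix.scalar (Fin 3) z - (x • A + y • B)).det = p.eval x y z := by
  -- The mixed coefficients are the polarizations of the second elementary symmetric function and of
  -- the determinant.
  refine ⟨⟨A.trace, B.trace, (A.trace ^ 2 - (A * A).trace) / 2,
    A.trace * B.trace - (A * B).trace, (B.trace ^ 2 - (B * B).trace) / 2, A.det,
    (A.adjugate * B).trace, (B.adjugate * A).trace, B.det⟩, fun x y z => ?_⟩
  simp only [Matrix.det_fin_three, Matrix.trace, Matrix.diag_apply, Fin.sum_univ_three,
    Matrix.mul_apply, Matrix.adjugate_fin_three, MonicCubicForm.eval, Matrix.sub_apply,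
    Matrix.add_apply, Matrix.smul_apply, smul_eq_mul, Matrix.scalar_apply,
    Matrix.diagonal_apply, Matrix.of_apply, Matrix.cons_val', Matrix.cons_val_zero,
    Matrix.cons_val_one, Matrix.cons_val, Matrix.cons_val_fin_one, Fin.isValue]
  simp
  ring

/-! ### Eigenvectors of exponentials -/

namespace Matrix

variable {n m : Type*} [Fintype n] [DecidableEq n]

open scoped Matrix.Norms.Operator in
-- The rectangular W serves both single eigenvectors and projections onto invariant subspaces.
lemma exp_mul_of_mul_eq_smul {Z : Matrix n n ℂ} {W : Matrix n m ℂ} {u : ℂ}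
    (h : Z * W = u • W) : NormedSpace.exp Z * W = Complex.exp u • W := by
  have hp : ∀ k : ℕ, Z ^ k * W = u ^ k • W := by
    intro k
    induction k with
    | zero => simp
    | succ k ih => rw [pow_succ, Matrix.mul_assoc, h, Matrix.mul_smul, ih, smul_smul, pow_succ,
        mul_comm]
  have h1 : HasSum (fun k : ℕ => (k.factorial⁻¹ : ℂ) • Z ^ k) (NormedSpace.exp Z) :=
    NormedSpace.exp_series_hasSum_exp' Z
  have h2 : HasSum (fun k : ℕ => (k.factorial⁻¹ : ℂ) • u ^ k) (Complex.exp u) := by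
    rw [Complex.exp_eq_exp_ℂ]; exact NormedSpace.exp_series_hasSum_exp' u
  ext i j
  have h3 : HasSum (fun k : ℕ => (((k.factorial⁻¹ : ℂ) • Z ^ k) * W) i j)
      ((NormedSpace.exp Z * W) i j) :=
    h1.map (AddMonoidHom.mk' (fun M : Matrix n n ℂ => (M * W) i j)
      (fun M M' => by simp [Matrix.add_mul])) (by
        change Continuous fun M : Matrix n n ℂ => (M * W) i j
        simp only [Matrix.mul_apply]
        fun_prop)
  have h4 := h2.mul_right (W i j)
  have e : ∀ k : ℕ, (((k.factorial⁻¹ : ℂ) • Z ^ k) * W) i j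
      = (k.factorial⁻¹ : ℂ) • u ^ k * W i j := fun k => by
    rw [Matrix.smul_mul, hp]
    simp [mul_assoc]
  simp only [e] at h3
  exact h3.unique h4

lemma exp_mulVec_of_mulVec_eq_smul {Z : Matrix n n ℂ} {v : n → ℂ} {u : ℂ}
    (h : Z *ᵥ v = u • v) : NormedSpace.exp Z *ᵥ v = Complex.exp u • v := by
  have := exp_mul_of_mul_eq_smul (Z := Z) (W := Matrix.replicateCol Unit v) (u := u) (by
    rw [← Matrix.replicateCol_mulVec, h, Matrix.replicateCol_smul])
  rw [← Matrix.replicateCol_mulVec, ← Matrix.replicateCol_smul] at this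
  exact Matrix.replicateCol_injective this

lemma mem_eigenspace_toLin' (X : Matrix n n ℂ) (a : ℂ) (w : n → ℂ) :
    w ∈ Module.End.eigenspace (Matrix.toLin' X) a ↔ X *ᵥ w = a • w := by
  rw [Module.End.mem_eigenspace_iff, Matrix.toLin'_apply]

lemma exists_eigenvector_mem {X : Matrix n n ℂ} {W : Submodule ℂ (n → ℂ)} (hW : W ≠ ⊥)
    (h : ∀ v ∈ W, X *ᵥ v ∈ W) : ∃ v ∈ W, v ≠ 0 ∧ ∃ a : ℂ, X *ᵥ v = a • v := by
  have : Nontrivial W := Submodule.nontrivial_iff_ne_bot.2 hW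
  obtain ⟨a, ha⟩ := Module.End.exists_eigenvalue ((Matrix.toLin' X).restrict (p := W) (q := W) h)
  obtain ⟨v, hv⟩ := ha.exists_hasEigenvector
  refine ⟨v, v.2, by simpa using hv.2, a, ?_⟩
  exact congrArg Subtype.val hv.apply_eq_smul

lemma eval_charpoly_eq_zero_of_mulVec_eq_smul {X : Matrix n n ℂ} {v : n → ℂ} (hv : v ≠ 0) {a : ℂ}
    (h : X *ᵥ v = a • v) : X.charpoly.eval a = 0 := by
  rw [Matrix.eval_charpoly, ← Matrix.exists_mulVec_eq_zero_iff]
  exact ⟨v, hv, by rw [Matrix.sub_mulVec, h]; simp [Matrix.scalar_apply]⟩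

lemma exists_mulVec_eq_smul_of_eval_charpoly_eq_zero {X : Matrix n n ℂ} {a : ℂ}
    (h : X.charpoly.eval a = 0) : ∃ v ≠ 0, X *ᵥ v = a • v := by
  rw [Matrix.eval_charpoly, ← Matrix.exists_mulVec_eq_zero_iff] at h
  obtain ⟨v, hv, h⟩ := h
  refine ⟨v, hv, ?_⟩
  rw [Matrix.sub_mulVec, sub_eq_zero] at h
  rw [← h]; simp [Matrix.scalar_apply]

/-- Every eigenvalue of the exponential of `A` is the exponential of an eigenvalue of `A`. -/
lemma exists_eq_exp_of_exp_mulVec_eq_smul {A : Matrix n n ℂ} {v : n → ℂ} (hv : v ≠ 0) {a : ℂ}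
    (h : NormedSpace.exp A *ᵥ v = a • v) : ∃ l, A.charpoly.eval l = 0 ∧ a = Complex.exp l := by
  let W := Module.End.eigenspace (Matrix.toLin' (NormedSpace.exp A)) a
  have hmem : ∀ w, w ∈ W ↔ NormedSpace.exp A *ᵥ w = a • w := mem_eigenspace_toLin' _ _
  obtain ⟨w, hw, hw0, l, hl⟩ := exists_eigenvector_mem (X := A) (W := W)
    (fun hb => hv (by simpa [hb] using (hmem v).2 h)) (fun w hw => by
      rw [hmem] at *
      rw [Matrix.mulVec_mulVec, ← ((Commute.refl A).exp_right).eq, ← Matrix.mulVec_mulVec, hw,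
        Matrix.mulVec_smul])
  refine ⟨l, eval_charpoly_eq_zero_of_mulVec_eq_smul hw0 hl, ?_⟩
  have h1 := exp_mulVec_of_mulVec_eq_smul hl
  rw [(hmem w).1 hw] at h1
  exact smul_left_injective ℂ hw0 h1

lemma exp_natCast_smul (t : ℕ) (A : Matrix n n ℂ) :
    NormedSpace.exp ((t : ℂ) • A) = NormedSpace.exp A ^ t := by
  rw [← Matrix.exp_nsmul, Nat.cast_smul_eq_nsmul]

/-- The eigenvalues of a product of powers of commuting exponentials. -/
lemma exists_exp_eq_of_exp_eq_pow_mul {A B Z : Matrix n n ℂ} {t : ℕ}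
    (hc : Commute (NormedSpace.exp A) (NormedSpace.exp B))
    (hZ : NormedSpace.exp Z = NormedSpace.exp A ^ t * NormedSpace.exp B) {z : ℂ}
    (hz : Z.charpoly.eval z = 0) : ∃ l m, A.charpoly.eval l = 0 ∧ B.charpoly.eval m = 0 ∧
      Complex.exp z = Complex.exp (t * l + m) := by
  obtain ⟨v, hv, h⟩ := exists_mulVec_eq_smul_of_eval_charpoly_eq_zero hz
  have hv2 := exp_mulVec_of_mulVec_eq_smul h
  set E := NormedSpace.exp A
  set F := NormedSpace.exp B
  rw [hZ] at hv2
  -- Inside this eigenspace, stable under E and F, find an eigenvector of E, and then in the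
  -- intersection with that eigenspace of E one of F: a joint eigenvector u.
  let W := Module.End.eigenspace (Matrix.toLin' (E ^ t * F)) (Complex.exp z)
  have hmem : ∀ w, w ∈ W ↔ (E ^ t * F) *ᵥ w = Complex.exp z • w := mem_eigenspace_toLin' _ _
  have hE : Commute (E ^ t * F) E := ((Commute.refl E).pow_left t).mul_left hc.symm
  have hF : Commute (E ^ t * F) F := (hc.pow_left t).mul_left (Commute.refl F)
  obtain ⟨w, hw, hw0, a, ha⟩ := exists_eigenvector_mem (X := E) (W := W)
    (fun hb => hv (by simpa [hb] using (hmem v).2 hv2)) (fun w hw => by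
      rw [hmem] at *
      rw [Matrix.mulVec_mulVec, hE.eq, ← Matrix.mulVec_mulVec, hw, Matrix.mulVec_smul])
  let W1 := Module.End.eigenspace (Matrix.toLin' E) a
  have hmem1 : ∀ w, w ∈ W1 ↔ E *ᵥ w = a • w := mem_eigenspace_toLin' _ _
  obtain ⟨u, hu, hu0, b, hb⟩ := exists_eigenvector_mem (X := F) (W := W ⊓ W1)
    (fun hb => hw0 (by
      have : w ∈ W ⊓ W1 := ⟨hw, (hmem1 w).2 ha⟩
      simpa [hb] using this)) (fun w hw => by
      obtain ⟨h1, h2⟩ := hw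
      refine ⟨?_, ?_⟩
      · change w ∈ W at h1
        change F *ᵥ w ∈ W
        rw [hmem] at *
        rw [Matrix.mulVec_mulVec, hF.eq, ← Matrix.mulVec_mulVec, h1, Matrix.mulVec_smul]
      · change w ∈ W1 at h2
        change F *ᵥ w ∈ W1
        rw [hmem1] at *
        rw [Matrix.mulVec_mulVec, hc.eq, ← Matrix.mulVec_mulVec, h2, Matrix.mulVec_smul])
  have hu1 := (hmem u).1 hu.1
  have hu2 := (hmem1 u).1 hu.2
  obtain ⟨l, hl, rfl⟩ := exists_eq_exp_of_exp_mulVec_eq_smul hu0 hu2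
  obtain ⟨m, hm, rfl⟩ := exists_eq_exp_of_exp_mulVec_eq_smul hu0 hb
  refine ⟨l, m, hl, hm, ?_⟩
  have hpow : ∀ k : ℕ, E ^ k *ᵥ u = Complex.exp l ^ k • u := by
    intro k
    induction k with
    | zero => simp
    | succ k ih => rw [pow_succ, ← Matrix.mulVec_mulVec, hu2, Matrix.mulVec_smul, ih, smul_smul,
        pow_succ, mul_comm]
  rw [← Matrix.mulVec_mulVec, hb, Matrix.mulVec_smul, hpow, smul_smul] at hu1
  have := smul_left_injective ℂ hu0 hu1
  rw [← this, Complex.exp_add, Complex.exp_nat_mul, mul_comm]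

end Matrix

/-- If `exp (t A + B) = exp (t A) exp B` for all large integers `t`, with commuting exponentials,
then `(A, B)` has property L. -/
theorem hasPropertyL_of_eventually {A B : Matrix (Fin 3) (Fin 3) ℂ}
    (hc : Commute (NormedSpace.exp A) (NormedSpace.exp B))
    (h : ∀ᶠ t : ℕ in atTop, NormedSpace.exp ((t : ℂ) • A + B)
      = NormedSpace.exp ((t : ℂ) • A) * NormedSpace.exp B) : HasPropertyL A B := by
  obtain ⟨p, hp⟩ := exists_monicCubicForm_eq_det A B
  have hA : ∀ l, A.charpoly.eval l = p.eval 1 0 l := fun l => by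
    rw [Matrix.eval_charpoly, ← hp]; simp
  obtain ⟨N, h⟩ := eventually_atTop.1 h
  have hroots : p.HasExpRoots := by
    refine ⟨B.charpoly.roots.toFinset, N, fun t ht z hz => ?_⟩
    have h1 := h t ht
    rw [Matrix.exp_natCast_smul] at h1
    obtain ⟨l, m, hl, hm, e⟩ := Matrix.exists_exp_eq_of_exp_eq_pow_mul hc h1 (z := z) (by
      rw [Matrix.eval_charpoly, ← hz, ← hp]; simp)
    refine ⟨l, by rw [← hA, hl], m, ?_, e⟩
    rw [Multiset.mem_toFinset, Polynomial.mem_roots B.charpoly_monic.ne_zero]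
    exact hm
  obtain ⟨lam, mu, hs⟩ := hroots.isSplit
  exact (hasPropertyL_iff A B).2 ⟨lam, mu, fun x y z => by rw [hp, hs]⟩

/-! ### Semisimple matrices and Jordan-Chevalley decompositions -/

/-- If the commutator `[B, E]` commutes with `E` and `E` is annihilated by a separable polynomial,
then `B` commutes with `E`. -/
lemma Commute.of_commutator_of_separable {K R : Type*} [Field K] [Ring R] [Algebra K R] {B E : R}
    (h : Commute (B * E - E * B) E) {p : Polynomial K} (hp : p.Separable)
    (hE : Polynomial.aeval E p = 0) : Commute B E := by
  set D := B * E - E * B with hD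
  -- The derivation [B, ·] sends q(E) to q'(E)D. For q = p this gives p'(E)D = 0, and p'(E) is
  -- invertible by the Bézout relation.
  have hder : ∀ q : Polynomial K, B * Polynomial.aeval E q - Polynomial.aeval E q * B
      = Polynomial.aeval E (Polynomial.derivative q) * D := by
    have hpow : ∀ n : ℕ, B * E ^ n - E ^ n * B = (n : R) * E ^ (n - 1) * D := by
      intro n
      induction n with
      | zero => simp
      | succ n ih =>
        have e1 : B * E ^ (n + 1) - E ^ (n + 1) * B
            = (B * E ^ n - E ^ n * B) * E + E ^ n * D := by
          rw [hD]; noncomm_ring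
        rw [e1, ih, mul_assoc _ D E, h.eq, ← mul_assoc]
        rcases Nat.eq_zero_or_pos n with rfl | hn
        · simp
        · rw [mul_assoc _ (E ^ (n - 1)) E, pow_sub_one_mul hn.ne']
          push_cast
          simp [add_mul]
    intro q
    induction q using Polynomial.induction_on' with
    | add p q hp hq =>
      simp only [map_add, mul_add, add_mul]
      rw [← hp, ← hq]; abel
    | monomial n a =>
      rw [Polynomial.derivative_monomial, Polynomial.aeval_monomial, Polynomial.aeval_monomial,
        mul_assoc, ← mul_assoc B, ← Algebra.commutes a B, mul_assoc, ← mul_sub, hpow]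
      simp [mul_assoc]
  have h1 := hder p
  rw [hE, mul_zero, zero_mul, sub_zero] at h1
  obtain ⟨u, v, huv⟩ := hp
  have h2 := congrArg (Polynomial.aeval E) huv
  rw [map_add, map_mul, map_mul, hE, mul_zero, zero_add, map_one] at h2
  have h3 : D = 0 := by
    rw [← one_mul D, ← h2, mul_assoc, ← h1, mul_zero]
  exact sub_eq_zero.1 h3

namespace Matrix

variable {n : Type*} [Fintype n] [DecidableEq n]

variable (n) in
/-- The identification of complex matrices with endomorphisms. -/
abbrev toEnd : Matrix n n ℂ ≃ₐ[ℂ] Module.End ℂ (n → ℂ) := Matrix.toLinAlgEquiv'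

/-- A complex matrix is semisimple if the endomorphism it represents is. -/
def IsSemisimple (X : Matrix n n ℂ) : Prop := Module.End.IsSemisimple (toEnd n X)

lemma IsSemisimple.squarefree_minpoly {X : Matrix n n ℂ} (h : X.IsSemisimple) :
    Squarefree (minpoly ℂ X) := by
  have := Module.End.IsSemisimple.minpoly_squarefree h
  rwa [minpoly.algEquiv_eq (toEnd n)] at this

lemma IsSemisimple.commute_of_commutator {E B : Matrix n n ℂ} (hE : E.IsSemisimple)
    (h : Commute (B * E - E * B) E) : Commute B E :=
  h.of_commutator_of_separable (PerfectField.separable_iff_squarefree.2 hE.squarefree_minpoly)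
    (minpoly.aeval ℂ E)

/-- For a semisimple matrix, generalized kernels are kernels. -/
lemma IsSemisimple.aeval_mul_eq_zero {X W : Matrix n n ℂ} (h : X.IsSemisimple)
    (q : Polynomial ℂ) (k : ℕ) (hk : k ≠ 0) (hW : Polynomial.aeval X (q ^ k) * W = 0) :
    Polynomial.aeval X q * W = 0 := by
  classical
  -- As a divisor of the squarefree minimal polynomial, the gcd is squarefree and so divides q; by
  -- Bézout its value at X kills W.
  have hg : EuclideanDomain.gcd (q ^ k) (minpoly ℂ X) ∣ q := by
    have hs : Squarefree (EuclideanDomain.gcd (q ^ k) (minpoly ℂ X)) :=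
      h.squarefree_minpoly.squarefree_of_dvd (EuclideanDomain.gcd_dvd_right _ _)
    exact (hs.dvd_pow_iff_dvd hk).1 (EuclideanDomain.gcd_dvd_left _ _)
  obtain ⟨r, hr⟩ := hg
  rw [EuclideanDomain.gcd_eq_gcd_ab, add_mul] at hr
  rw [hr, map_add, add_mul, mul_right_comm, mul_assoc (minpoly ℂ X), map_mul (x := minpoly ℂ X),
    minpoly.aeval, zero_mul, zero_mul, add_zero, mul_assoc, mul_comm, map_mul, Matrix.mul_assoc, hW,
    Matrix.mul_zero]

lemma IsSemisimple.mul {X Y : Matrix n n ℂ} (hX : X.IsSemisimple) (hY : Y.IsSemisimple)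
    (h : Commute X Y) : (X * Y).IsSemisimple := by
  rw [IsSemisimple, map_mul]
  exact Module.End.IsSemisimple.mul_of_commute (f := toEnd n X) (g := toEnd n Y) (h.map (toEnd n)) hX hY

lemma IsSemisimple.conj {X P Q : Matrix n n ℂ} (hX : X.IsSemisimple) (h : P * Q = 1) :
    (Q * X * P).IsSemisimple := by
  refine Module.End.isSemisimple_of_squarefree_aeval_eq_zero (f := toEnd n (Q * X * P)) hX.squarefree_minpoly ?_
  have h' : Q * P = 1 := mul_eq_one_comm.1 h
  have hconj : ∀ q : Polynomial ℂ, Polynomial.aeval (Q * X * P) q = Q * Polynomial.aeval X q * P := by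
    intro q
    induction q using Polynomial.induction_on' with
    | add p q hp hq => rw [map_add, map_add, hp, hq]; noncomm_ring
    | monomial k a =>
      have hpow : (Q * X * P) ^ k = Q * X ^ k * P := by
        induction k with
        | zero => simp [h']
        | succ k ih =>
          rw [pow_succ, ih, pow_succ]
          calc Q * X ^ k * P * (Q * X * P) = Q * X ^ k * (P * Q) * X * P := by noncomm_ring
            _ = _ := by rw [h]; noncomm_ring
      rw [Polynomial.aeval_monomial, Polynomial.aeval_monomial, hpow]
      simp only [Matrix.algebraMap_eq_diagonal, ← Matrix.smul_eq_diagonal_mul, Pi.algebraMap_def]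
      simp [Matrix.mul_assoc]
  rw [← AlgEquiv.coe_toAlgHom, Polynomial.aeval_algHom_apply, hconj, minpoly.aeval]
  simp

/-- The algebra generated by X is finite-dimensional, hence closed, so exp X is a polynomial in X.
-/
lemma IsSemisimple.exp {X : Matrix n n ℂ} (h : X.IsSemisimple) :
    (NormedSpace.exp X).IsSemisimple := by
  have hcl : IsClosed ((Algebra.adjoin ℂ {X} : Subalgebra ℂ (Matrix n n ℂ)) : Set (Matrix n n ℂ)) :=
    Submodule.closed_of_finiteDimensional (Subalgebra.toSubmodule (Algebra.adjoin ℂ {X}))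
  have hmem : NormedSpace.exp X ∈ Algebra.adjoin ℂ {X} :=
    NormedSpace.exp_mem (R := ℂ) hcl (Algebra.self_mem_adjoin_singleton ℂ X)
  rw [Algebra.adjoin_singleton_eq_range_aeval] at hmem
  obtain ⟨q, hq⟩ := hmem
  rw [IsSemisimple, ← hq]
  change Module.End.IsSemisimple (toEnd n (Polynomial.aeval X q))
  rw [← AlgEquiv.coe_toAlgHom, ← Polynomial.aeval_algHom_apply]
  exact Module.End.IsSemisimple.aeval h q

/-- The Jordan-Chevalley decomposition of a complex matrix. -/
lemma exists_jordanChevalley (X : Matrix n n ℂ) : ∃ S N : Matrix n n ℂ, X = S + N ∧ Commute S N ∧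
    S.IsSemisimple ∧ IsNilpotent N ∧ ∀ Y, Commute Y X → Commute Y S ∧ Commute Y N := by
  obtain ⟨f, hf, s, hs, hfn, hss, hfs⟩ :=
    Module.End.exists_isNilpotent_isSemisimple (f := (toEnd n) X)
  have hcomm : ∀ Y, Commute Y X → Commute Y ((toEnd n).symm s) ∧
      Commute Y ((toEnd n).symm f) := by
    intro Y hY
    have hY' := hY.map (toEnd n)
    have h1 := (Algebra.commute_of_mem_adjoin_singleton_of_commute hs hY').map
      (toEnd n).symm
    have h2 := (Algebra.commute_of_mem_adjoin_singleton_of_commute hf hY').map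
      (toEnd n).symm
    rw [AlgEquiv.symm_apply_apply] at h1 h2
    exact ⟨h1, h2⟩
  refine ⟨(toEnd n).symm s, (toEnd n).symm f, ?_, ?_, ?_, ?_, hcomm⟩
  · rw [← map_add, add_comm, ← hfs, AlgEquiv.symm_apply_apply]
  · exact (hcomm _ (hcomm X (Commute.refl X)).1.symm).2
  · rw [IsSemisimple, AlgEquiv.apply_symm_apply]; exact hss
  · exact hfn.map _

lemma jordanChevalley_unique {S N S' N' : Matrix n n ℂ} (hS : S.IsSemisimple)
    (hN : IsNilpotent N) (hSN : Commute S N) (hS' : S'.IsSemisimple) (hN' : IsNilpotent N')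
    (hSN' : Commute S' N') (h : S + N = S' + N') : S = S' ∧ N = N' := by
  obtain ⟨h1, h2⟩ := Module.End.isNilpotent_isSemisimple_unique
    (hN.map (toEnd n)) hS
    (hN'.map (toEnd n)) hS'
    (hSN.symm.map _) (hSN'.symm.map _) (by rw [← map_add, ← map_add, add_comm, h, add_comm])
  exact ⟨(toEnd n).injective h2, (toEnd n).injective h1⟩

lemma _root_.IsNilpotent.matrix_charpoly_eq {N : Matrix n n ℂ} (h : IsNilpotent N) :
    N.charpoly = Polynomial.X ^ Fintype.card n :=
  sub_eq_zero.1 (Matrix.isNilpotent_charpoly_sub_pow_of_isNilpotent h).eq_zero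

lemma _root_.IsNilpotent.matrix_pow_card_eq_zero {N : Matrix n n ℂ} (h : IsNilpotent N) :
    N ^ Fintype.card n = 0 := by
  have := Matrix.aeval_self_charpoly N
  rwa [h.matrix_charpoly_eq, map_pow, Polynomial.aeval_X] at this

open scoped Matrix.Norms.Operator in
lemma exp_of_pow_three_eq_zero {N : Matrix n n ℂ} (h : N ^ 3 = 0) :
    NormedSpace.exp N = 1 + N + (1 / 2 : ℂ) • N ^ 2 := by
  have h1 : HasSum (fun k : ℕ => (k.factorial⁻¹ : ℂ) • N ^ k) (NormedSpace.exp N) :=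
    NormedSpace.exp_series_hasSum_exp' N
  have h2 : HasSum (fun k : ℕ => (k.factorial⁻¹ : ℂ) • N ^ k)
      (∑ k ∈ Finset.range 3, (k.factorial⁻¹ : ℂ) • N ^ k) := by
    refine hasSum_sum_of_ne_finset_zero fun k hk => ?_
    rw [Finset.mem_range, not_lt] at hk
    rw [pow_eq_zero_of_le hk h, smul_zero]
  rw [h1.unique h2]
  simp [Finset.sum_range_succ, Nat.factorial]

/-- The logarithm of the exponential of a nilpotent `3 × 3` matrix. -/
lemma eq_log_exp_of_pow_three_eq_zero {N U : Matrix n n ℂ} (h : N ^ 3 = 0)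
    (hU : U = NormedSpace.exp N) : N = (U - 1) - (1 / 2 : ℂ) • (U - 1) ^ 2 := by
  have h4 : N * N ^ 2 = 0 := by rw [← pow_succ', h]
  have h5 : N ^ 2 * N = 0 := by rw [← pow_succ, h]
  have h6 : N ^ 2 * N ^ 2 = 0 := by rw [← pow_add, pow_eq_zero_of_le (by norm_num) h]
  rw [hU, exp_of_pow_three_eq_zero h]
  have e : (1 + N + (1 / 2 : ℂ) • N ^ 2 - 1) = N + (1 / 2 : ℂ) • N ^ 2 := by abel
  rw [e, pow_two (N + _), mul_add, add_mul, add_mul, Matrix.mul_smul, Matrix.smul_mul,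
    Matrix.smul_mul, Matrix.mul_smul, h4, h5, h6, ← pow_two]
  simp

lemma isNilpotent_exp_sub_one {N : Matrix n n ℂ} (h : N ^ 3 = 0) :
    IsNilpotent (NormedSpace.exp N - 1) := by
  rw [exp_of_pow_three_eq_zero h]
  have e : (1 + N + (1 / 2 : ℂ) • N ^ 2 - 1) = N * (1 + (1 / 2 : ℂ) • N) := by
    rw [mul_add, Matrix.mul_smul, ← pow_two]; simp; abel
  rw [e]
  refine Commute.isNilpotent_mul_right ?_ ⟨3, h⟩
  exact ((Commute.one_right N).add_right ((Commute.refl N).smul_right _))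

/-- Multiplicative Jordan-Chevalley decompositions are unique. -/
lemma eq_of_mul_exp_eq_mul_exp {S S' N N' : Matrix n n ℂ} (hS : S.IsSemisimple)
    (hu : IsUnit S) (hN : N ^ 3 = 0) (hSN : Commute S N) (hS' : S'.IsSemisimple)
    (hN' : N' ^ 3 = 0) (hSN' : Commute S' N')
    (h : S * NormedSpace.exp N = S' * NormedSpace.exp N') : S = S' ∧ N = N' := by
  have hcS : ∀ {S N : Matrix n n ℂ}, Commute S N → Commute S (NormedSpace.exp N - 1) := fun h =>
    h.exp_right.sub_right (Commute.one_right _)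
  have hnil : ∀ {S N : Matrix n n ℂ}, N ^ 3 = 0 → Commute S N →
      IsNilpotent (S * (NormedSpace.exp N - 1)) := fun h3 h =>
    Commute.isNilpotent_mul_left (hcS h) (isNilpotent_exp_sub_one h3)
  -- S exp N = S + S(exp N - 1) is an additive Jordan-Chevalley decomposition.
  obtain ⟨h1, h2⟩ := jordanChevalley_unique hS (hnil hN hSN)
    ((Commute.refl S).mul_right (hcS hSN)) hS' (hnil hN' hSN')
    ((Commute.refl S').mul_right (hcS hSN')) (by rw [mul_sub, mul_sub, mul_one, mul_one, h]; abel)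
  subst h1
  refine ⟨rfl, ?_⟩
  have h3 : NormedSpace.exp N = NormedSpace.exp N' := hu.mul_left_cancel h
  rw [eq_log_exp_of_pow_three_eq_zero hN rfl, eq_log_exp_of_pow_three_eq_zero hN' rfl, h3]

/-- A matrix commuting with `exp X` commutes with the exponential of the semisimple part of `X`
and with the nilpotent part of `X`. -/
lemma commute_of_commute_exp {S N Y : Matrix n n ℂ} (hS : S.IsSemisimple) (hN : N ^ 3 = 0)
    (hSN : Commute S N) (h : Commute Y (NormedSpace.exp (S + N))) :
    Commute Y (NormedSpace.exp S) ∧ Commute Y N := by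
  rw [Matrix.exp_add_of_commute _ _ hSN] at h
  have hu : IsUnit (NormedSpace.exp S) := Matrix.isUnit_exp S
  have hc : Commute (NormedSpace.exp S) (NormedSpace.exp N - 1) :=
    hSN.exp.sub_right (Commute.one_right _)
  -- The additive parts of exp(S + N) are exp S and exp S (exp N - 1), and Y commutes with both; N
  -- is then recovered as a polynomial in exp N.
  obtain ⟨S', N', hX, hSN', hS', hN', hcomm⟩ :=
    exists_jordanChevalley (NormedSpace.exp S * NormedSpace.exp N)
  obtain ⟨h1, h2⟩ := jordanChevalley_unique hS.exp
    (Commute.isNilpotent_mul_left hc (isNilpotent_exp_sub_one hN))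
    ((Commute.refl _).mul_right hc) hS' hN' hSN' (by rw [← hX]; noncomm_ring)
  obtain ⟨h3, h4⟩ := hcomm Y h
  rw [← h1] at h3
  rw [← h2] at h4
  refine ⟨h3, ?_⟩
  have h5 : Commute Y (NormedSpace.exp N - 1) := by
    refine hu.mul_left_cancel ?_
    rw [← mul_assoc, ← h3.eq, mul_assoc, h4.eq, mul_assoc]
  rw [eq_log_exp_of_pow_three_eq_zero hN rfl]
  exact h5.sub_right ((h5.pow_right 2).smul_right _)

end Matrix

/-! ### Semisimple pairs with scalar exponentials -/

namespace Matrix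

section
variable {n m : Type*} [Fintype n] [DecidableEq n]

lemma exp_mul_of_sub_mul_eq_zero {Z : Matrix n n ℂ} {W : Matrix n m ℂ} {u : ℂ}
    (h : (Z - u • (1 : Matrix n n ℂ)) * W = 0) : NormedSpace.exp Z * W = Complex.exp u • W := by
  refine exp_mul_of_mul_eq_smul ?_
  rw [Matrix.sub_mul, sub_eq_zero] at h
  rw [h, Matrix.smul_mul, Matrix.one_mul]

lemma eq_zero_of_mul_sub_smul {T Z : Matrix n n ℂ} {W : Matrix n m ℂ} {u v : ℂ} (huv : u ≠ v)
    (h1 : T * ((Z - u • (1 : Matrix n n ℂ)) * W) = 0)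
    (h2 : T * ((Z - v • (1 : Matrix n n ℂ)) * W) = 0) : T * W = 0 := by
  have h3 : (v - u) • (T * W) = 0 := by
    have := congrArg₂ (· - ·) h1 h2
    simp only [sub_zero] at this
    rw [← this]
    simp only [Matrix.sub_mul, Matrix.mul_sub, Matrix.smul_mul, Matrix.mul_smul, Matrix.one_mul]
    module
  exact (smul_eq_zero.1 h3).resolve_left (sub_ne_zero.2 huv.symm)

/-- exp Z - g kills both (Z - u)W and (Z - v)W, whose difference is a nonzero multiple of W. -/
lemma exp_mul_of_two_eigenvalues {Z : Matrix n n ℂ} {W : Matrix n m ℂ} {u v g : ℂ} (huv : u ≠ v)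
    (h : (Z - u • (1 : Matrix n n ℂ)) * ((Z - v • (1 : Matrix n n ℂ)) * W) = 0)
    (hu : Complex.exp u = g) (hv : Complex.exp v = g) : NormedSpace.exp Z * W = g • W := by
  have hcomm : (Z - v • (1 : Matrix n n ℂ)) * ((Z - u • (1 : Matrix n n ℂ)) * W) = 0 := by
    rw [← h, ← Matrix.mul_assoc, ← Matrix.mul_assoc]
    congr 1
    simp only [sub_mul, mul_sub, Matrix.smul_mul, Matrix.mul_smul, Matrix.one_mul, Matrix.mul_one]
    module
  have h1 := exp_mul_of_sub_mul_eq_zero h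
  have h2 := exp_mul_of_sub_mul_eq_zero hcomm
  have := eq_zero_of_mul_sub_smul (T := NormedSpace.exp Z - g • (1 : Matrix n n ℂ)) (Z := Z)
    (W := W) huv (by rw [Matrix.sub_mul, h2, hv, Matrix.smul_mul, Matrix.one_mul, sub_self])
    (by rw [Matrix.sub_mul, h1, hu, Matrix.smul_mul, Matrix.one_mul, sub_self])
  rwa [Matrix.sub_mul, Matrix.smul_mul, Matrix.one_mul, sub_eq_zero] at this

lemma exp_mul_of_three_eigenvalues {Z : Matrix n n ℂ} {W : Matrix n m ℂ} {u v w g : ℂ}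
    (huv : u ≠ v) (huw : u ≠ w) (hvw : v ≠ w)
    (h : (Z - u • (1 : Matrix n n ℂ)) * ((Z - v • (1 : Matrix n n ℂ)) *
      ((Z - w • (1 : Matrix n n ℂ)) * W)) = 0)
    (hu : Complex.exp u = g) (hv : Complex.exp v = g) (hw : Complex.exp w = g) :
    NormedSpace.exp Z * W = g • W := by
  have hcomm : (Z - u • (1 : Matrix n n ℂ)) * ((Z - w • (1 : Matrix n n ℂ)) *
      ((Z - v • (1 : Matrix n n ℂ)) * W)) = 0 := by
    rw [← h, ← Matrix.mul_assoc (Z - w • _), ← Matrix.mul_assoc (Z - v • _)]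
    congr 2
    simp only [sub_mul, mul_sub, Matrix.smul_mul, Matrix.mul_smul, Matrix.one_mul, Matrix.mul_one]
    module
  have h1 := exp_mul_of_two_eigenvalues huv h hu hv
  have h2 := exp_mul_of_two_eigenvalues huw hcomm hu hw
  have := eq_zero_of_mul_sub_smul (T := NormedSpace.exp Z - g • (1 : Matrix n n ℂ)) (Z := Z)
    (W := W) hvw (by rw [Matrix.sub_mul, h2, Matrix.smul_mul, Matrix.one_mul, sub_self])
    (by rw [Matrix.sub_mul, h1, Matrix.smul_mul, Matrix.one_mul, sub_self])
  rwa [Matrix.sub_mul, Matrix.smul_mul, Matrix.one_mul, sub_eq_zero] at this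

lemma exp_natCast_smul_add_of_commute {A B : Matrix n n ℂ} (h : Commute A B) (t : ℕ) :
    NormedSpace.exp ((t : ℂ) • A + B) = NormedSpace.exp ((t : ℂ) • A) * NormedSpace.exp B :=
  Matrix.exp_add_of_commute _ _ (h.smul_left _)

/-- In the semisimple case, the relation `exp (A + B) = exp A * exp B = exp B * exp A` makes
`A` commute with `exp B` and `B` with `exp A`. -/
lemma commute_exp_of_exp_add {A B : Matrix n n ℂ} (hA : A.IsSemisimple)
    (hc : Commute (NormedSpace.exp A) (NormedSpace.exp B))
    (h : NormedSpace.exp (A + B) = NormedSpace.exp A * NormedSpace.exp B) :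
    Commute B (NormedSpace.exp A) ∧ Commute A (NormedSpace.exp B) := by
  have hAE : Commute A (NormedSpace.exp A) := (Commute.refl A).exp_right
  have hBF : Commute B (NormedSpace.exp B) := (Commute.refl B).exp_right
  have hC : Commute (A + B) (NormedSpace.exp (A + B)) := (Commute.refl (A + B)).exp_right
  have huE : IsUnit (NormedSpace.exp A) := Matrix.isUnit_exp A
  have huF : IsUnit (NormedSpace.exp B) := Matrix.isUnit_exp B
  have hES := hA.exp
  rw [h] at hC
  set E := NormedSpace.exp A
  set F := NormedSpace.exp B
  -- This is the commutation of A + B with its exponential EF, expanded. The right side commutes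
  -- with E, hence so does [B, E], because F is invertible and commutes with E.
  have hkey : (B * E - E * B) * F = E * (F * A - A * F) := by
    have h1 : (A + B) * (E * F) = E * F * (A + B) := hC.eq
    calc (B * E - E * B) * F = (A + B) * (E * F) - (A * E) * F - E * (B * F) := by noncomm_ring
      _ = E * F * (A + B) - (E * A) * F - E * (F * B) := by rw [h1, hAE.eq, hBF.eq]
      _ = _ := by noncomm_ring
  have hR : Commute (E * (F * A - A * F)) E :=
    (Commute.refl E).mul_left ((hc.symm.mul_left hAE).sub_left (hAE.mul_left hc.symm))
  have hD : Commute (B * E - E * B) E := by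
    refine huF.mul_right_cancel ?_
    rw [mul_assoc, hc.eq, ← mul_assoc, hkey, hR.eq, ← hkey, mul_assoc]
  have hBE := hES.commute_of_commutator hD
  refine ⟨hBE, ?_⟩
  rw [hBE.eq, sub_self, zero_mul] at hkey
  have h2 : F * A - A * F = 0 := huE.mul_left_cancel (by rw [← hkey, mul_zero])
  exact (sub_eq_zero.1 h2).symm

lemma aeval_sub_mul_sub (X : Matrix n n ℂ) (a b : ℂ) :
    Polynomial.aeval X ((Polynomial.X - Polynomial.C a) * (Polynomial.X - Polynomial.C b))
      = (X - a • (1 : Matrix n n ℂ)) * (X - b • (1 : Matrix n n ℂ)) := by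
  simp [Algebra.algebraMap_eq_smul_one]

end

/-- If the pencil spanned by `A` and `B` has a double eigenvalue, the semisimple case with scalar
exponentials follows from the quadratic equations satisfied by `A`, `B` and `A + B`. -/
lemma eventually_exp_of_scalar_of_double {A B : Matrix (Fin 3) (Fin 3) ℂ} (hA : A.IsSemisimple)
    (hB : B.IsSemisimple) (hC : (A + B).IsSemisimple) {e f l m l' m' : ℂ}
    (hE : NormedSpace.exp A = e • (1 : Matrix (Fin 3) (Fin 3) ℂ))
    (hF : NormedSpace.exp B = f • (1 : Matrix (Fin 3) (Fin 3) ℂ))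
    (hl : Complex.exp l = e) (hl' : Complex.exp l' = e) (hm : Complex.exp m = f)
    (hm' : Complex.exp m' = f)
    (h : ∀ x y z, (Matrix.scalar (Fin 3) z - (x • A + y • B)).det
      = (z - (x * l + y * m)) ^ 2 * (z - (x * l' + y * m'))) :
    ∀ᶠ t : ℕ in atTop, NormedSpace.exp ((t : ℂ) • A + B)
      = NormedSpace.exp ((t : ℂ) • A) * NormedSpace.exp B := by
  have hquad : ∀ {X : Matrix (Fin 3) (Fin 3) ℂ} (_ : X.IsSemisimple) {a b : ℂ}
      (_ : ∀ z, (Matrix.scalar (Fin 3) z - X).det = (z - a) ^ 2 * (z - b)),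
      (X - a • (1 : Matrix (Fin 3) (Fin 3) ℂ)) * (X - b • (1 : Matrix (Fin 3) (Fin 3) ℂ)) = 0 := by
    intro X hX a b hdet
    have hchar : X.charpoly = (Polynomial.X - Polynomial.C a) ^ 2
        * (Polynomial.X - Polynomial.C b) := by
      refine Polynomial.funext fun z => ?_
      rw [Matrix.eval_charpoly, hdet]; simp
    have h0 := hX.aeval_mul_eq_zero (W := 1)
      ((Polynomial.X - Polynomial.C a) * (Polynomial.X - Polynomial.C b)) 2 two_ne_zero (by
        have : ((Polynomial.X - Polynomial.C a) * (Polynomial.X - Polynomial.C b)) ^ 2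
            = X.charpoly * (Polynomial.X - Polynomial.C b) := by rw [hchar]; ring
        rw [this, map_mul, Matrix.aeval_self_charpoly, zero_mul, zero_mul])
    rwa [mul_one, aeval_sub_mul_sub] at h0
  have qA := hquad hA (a := l) (b := l') (fun z => by simpa using h 1 0 z)
  have qB := hquad hB (a := m) (b := m') (fun z => by simpa using h 0 1 z)
  have qC := hquad hC (a := l + m) (b := l' + m') (fun z => by simpa using h 1 1 z)
  have hscal : ∀ {X : Matrix (Fin 3) (Fin 3) ℂ} (_ : X.IsSemisimple) {a : ℂ}
      (_ : (X - a • (1 : Matrix (Fin 3) (Fin 3) ℂ)) * (X - a • (1 : Matrix (Fin 3) (Fin 3) ℂ)) = 0),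
      X = a • (1 : Matrix (Fin 3) (Fin 3) ℂ) := by
    intro X hX a hq
    have h0 := hX.aeval_mul_eq_zero (W := 1) (Polynomial.X - Polynomial.C a) 2 two_ne_zero (by
      rw [pow_two, aeval_sub_mul_sub, hq, zero_mul])
    rw [mul_one] at h0
    simp [Algebra.algebraMap_eq_smul_one] at h0
    exact sub_eq_zero.1 h0
  by_cases hll : l = l'
  · subst hll
    rw [hscal hA qA]
    exact Eventually.of_forall fun t =>
      exp_natCast_smul_add_of_commute ((Commute.one_left B).smul_left l) t
  have hne : ∀ᶠ t : ℕ in atTop, (t : ℂ) * l + m ≠ t * l' + m' := by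
    filter_upwards [eventually_linear_ne_zero (sub_ne_zero.2 hll) (m - m')] with t ht he
    exact ht (by linear_combination he)
  filter_upwards [hne] with t ht
  -- For xA + yB the corresponding product is a quadratic form in (x, y). It vanishes at (1, 0), (0,
  -- 1) and (1, 1), hence everywhere; the coefficients below are the interpolation at (t, 1).
  have hZ : ((t : ℂ) • A + B - ((t : ℂ) * l + m) • (1 : Matrix (Fin 3) (Fin 3) ℂ)) *
      (((t : ℂ) • A + B - ((t : ℂ) * l' + m') • (1 : Matrix (Fin 3) (Fin 3) ℂ)) * 1) = 0 := by
    simp only [sub_mul, mul_sub, add_mul, mul_add, Matrix.smul_mul, Matrix.mul_smul, Matrix.one_mul,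
      Matrix.mul_one] at qA qB qC ⊢
    linear_combination (norm := module) ((t : ℂ) ^ 2 - t) • qA + ((1 : ℂ) - t) • qB + (t : ℂ) • qC
  have hexp : ∀ {a b : ℂ}, Complex.exp a = e → Complex.exp b = f →
      Complex.exp (t * a + b) = e ^ t * f := fun ha hb => by
    rw [Complex.exp_add, Complex.exp_nat_mul, ha, hb]
  have := exp_mul_of_two_eigenvalues ht hZ (hexp hl hm) (hexp hl' hm')
  rw [mul_one] at this
  rw [this, exp_natCast_smul, hE, hF, smul_pow, one_pow]
  simp [smul_smul, mul_comm]

/-- The semisimple case with scalar exponentials. -/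
lemma eventually_exp_of_scalar {A B : Matrix (Fin 3) (Fin 3) ℂ} (hA : A.IsSemisimple)
    (hB : B.IsSemisimple) (hC : (A + B).IsSemisimple) {e f : ℂ}
    (hE : NormedSpace.exp A = e • (1 : Matrix (Fin 3) (Fin 3) ℂ))
    (hF : NormedSpace.exp B = f • (1 : Matrix (Fin 3) (Fin 3) ℂ)) (hL : HasPropertyL A B) :
    ∀ᶠ t : ℕ in atTop, NormedSpace.exp ((t : ℂ) • A + B)
      = NormedSpace.exp ((t : ℂ) • A) * NormedSpace.exp B := by
  obtain ⟨lam, mu, h⟩ := (hasPropertyL_iff A B).1 hL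
  have hroot : ∀ {X : Matrix (Fin 3) (Fin 3) ℂ} {g a : ℂ},
      NormedSpace.exp X = g • (1 : Matrix (Fin 3) (Fin 3) ℂ) →
      (Matrix.scalar (Fin 3) a - X).det = 0 → Complex.exp a = g := by
    intro X g a hX ha
    rw [← Matrix.eval_charpoly] at ha
    obtain ⟨v, hv, hva⟩ := exists_mulVec_eq_smul_of_eval_charpoly_eq_zero ha
    have := exp_mulVec_of_mulVec_eq_smul hva
    rw [hX, Matrix.smul_mulVec, Matrix.one_mulVec] at this
    exact (smul_left_injective ℂ hv this).symm
  have hl : ∀ i, Complex.exp (lam i) = e := fun i => hroot hE (by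
    have := h 1 0 (lam i)
    rw [Finset.prod_eq_zero (Finset.mem_univ i) (by ring)] at this
    simpa using this)
  have hm : ∀ i, Complex.exp (mu i) = f := fun i => hroot hF (by
    have := h 0 1 (mu i)
    rw [Finset.prod_eq_zero (Finset.mem_univ i) (by ring)] at this
    simpa using this)
  have hdouble : ∀ i j k : Fin 3, (∀ x y z, (Matrix.scalar (Fin 3) z - (x • A + y • B)).det
      = (z - (x * lam i + y * mu i)) * (z - (x * lam j + y * mu j))
        * (z - (x * lam k + y * mu k))) → lam i = lam j ∧ mu i = mu j →
      ∀ᶠ t : ℕ in atTop, NormedSpace.exp ((t : ℂ) • A + B)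
      = NormedSpace.exp ((t : ℂ) • A) * NormedSpace.exp B := by
    rintro i j k hd ⟨h1, h2⟩
    exact eventually_exp_of_scalar_of_double hA hB hC hE hF (hl i) (hl k) (hm i) (hm k)
      (fun x y z => by rw [hd, h1, h2]; ring)
  by_cases h01 : lam 0 = lam 1 ∧ mu 0 = mu 1
  · exact hdouble 0 1 2 (fun x y z => by rw [h, Fin.prod_univ_three]) h01
  by_cases h02 : lam 0 = lam 2 ∧ mu 0 = mu 2
  · exact hdouble 0 2 1 (fun x y z => by rw [h, Fin.prod_univ_three]; ring) h02
  by_cases h12 : lam 1 = lam 2 ∧ mu 1 = mu 2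
  · exact hdouble 1 2 0 (fun x y z => by rw [h, Fin.prod_univ_three]; ring) h12
  -- The pairs (λ, μ) are now pairwise distinct, so tA + B has simple spectrum for large t.
  have hne : ∀ i j, ¬ (lam i = lam j ∧ mu i = mu j) → ∀ᶠ t : ℕ in atTop,
      (t : ℂ) * lam i + mu i ≠ t * lam j + mu j := by
    intro i j hij
    by_cases hlij : lam i = lam j
    · have : mu i ≠ mu j := fun hh => hij ⟨hlij, hh⟩
      exact Eventually.of_forall fun t => by rw [hlij]; simpa using this
    · filter_upwards [eventually_linear_ne_zero (sub_ne_zero.2 hlij) (mu i - mu j)] with t ht he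
      exact ht (by linear_combination he)
  filter_upwards [hne 0 1 h01, hne 0 2 h02, hne 1 2 h12] with t t01 t02 t12
  have hexp : ∀ i, Complex.exp (t * lam i + mu i) = e ^ t * f := fun i => by
    rw [Complex.exp_add, Complex.exp_nat_mul, hl, hm]
  set Z := (t : ℂ) • A + B
  have hZ : (Z - ((t : ℂ) * lam 0 + mu 0) • (1 : Matrix (Fin 3) (Fin 3) ℂ)) *
      ((Z - ((t : ℂ) * lam 1 + mu 1) • (1 : Matrix (Fin 3) (Fin 3) ℂ)) *
        ((Z - ((t : ℂ) * lam 2 + mu 2) • (1 : Matrix (Fin 3) (Fin 3) ℂ)) * 1)) = 0 := by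
    have hchar : Z.charpoly = (Polynomial.X - Polynomial.C ((t : ℂ) * lam 0 + mu 0)) *
        ((Polynomial.X - Polynomial.C ((t : ℂ) * lam 1 + mu 1)) *
        (Polynomial.X - Polynomial.C ((t : ℂ) * lam 2 + mu 2))) := by
      refine Polynomial.funext fun z => ?_
      have := h t 1 z
      rw [one_smul, Fin.prod_univ_three] at this
      rw [Matrix.eval_charpoly, this]
      simp [mul_assoc]
    have h0 := Matrix.aeval_self_charpoly Z
    rw [hchar, map_mul, aeval_sub_mul_sub, map_sub, Polynomial.aeval_X, Polynomial.aeval_C,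
      Algebra.algebraMap_eq_smul_one] at h0
    rw [mul_one, ← h0]
  have := exp_mul_of_three_eigenvalues t01 t02 t12 hZ (hexp 0) (hexp 1) (hexp 2)
  rw [mul_one] at this
  rw [this, exp_natCast_smul, hE, hF, smul_pow, one_pow]
  simp [smul_smul, mul_comm]

end Matrix

/-! ### Diagonalization and block diagonal pairs -/

namespace Matrix

/-- Generalized eigenspaces span over ℂ and coincide with eigenspaces by semisimplicity; a basis is
extracted from their union. -/
lemma IsSemisimple.exists_eigenbasis {K : Matrix (Fin 3) (Fin 3) ℂ} (h : K.IsSemisimple) :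
    ∃ (b : Module.Basis (Fin 3) ℂ (Fin 3 → ℂ)) (d : Fin 3 → ℂ), ∀ i, K *ᵥ b i = d i • b i := by
  set f := toEnd (Fin 3) K
  have hf : ⨆ μ, f.eigenspace μ = ⊤ := by
    rw [← Module.End.iSup_maxGenEigenspace_eq_top f]
    refine iSup_congr fun μ => ?_
    have hs : f.IsFinitelySemisimple := Module.End.IsSemisimple.isFinitelySemisimple h
    exact (hs.genEigenspace_eq_eigenspace μ (by simp)).symm
  set T : Set (Fin 3 → ℂ) := ⋃ μ, (f.eigenspace μ : Set (Fin 3 → ℂ))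
  have hT : Submodule.span ℂ T = ⊤ := by
    rw [Submodule.span_iUnion, ← hf]
    simp
  obtain ⟨s, hsT, hspan, hli⟩ := exists_linearIndependent ℂ T
  let b0 : Module.Basis s ℂ (Fin 3 → ℂ) := Module.Basis.mk hli (by
    rw [Subtype.range_coe, hspan, hT])
  have : Finite s := Module.Finite.finite_basis b0
  have := Fintype.ofFinite s
  have hcard : Fintype.card s = 3 := by
    rw [← Module.finrank_eq_card_basis b0]; simp
  let b := b0.reindex (Fintype.equivFinOfCardEq hcard)
  have hb : ∀ i, ∃ μ : ℂ, K *ᵥ b i = μ • b i := by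
    intro i
    have hm : b i ∈ T := by
      simp only [b, b0, Module.Basis.reindex_apply, Module.Basis.mk_apply]
      exact hsT (Subtype.coe_prop _)
    obtain ⟨μ, hμ⟩ := Set.mem_iUnion.1 hm
    exact ⟨μ, (mem_eigenspace_toLin' K μ (b i)).1 hμ⟩
  choose d hd using hb
  exact ⟨b, d, hd⟩

/-- A non-scalar semisimple `3 × 3` matrix is similar to a diagonal matrix whose first entry is
a simple eigenvalue. -/
lemma IsSemisimple.exists_diagonalization {K : Matrix (Fin 3) (Fin 3) ℂ} (h : K.IsSemisimple)
    (hK : ∀ c : ℂ, K ≠ c • (1 : Matrix (Fin 3) (Fin 3) ℂ)) :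
    ∃ (P Q : Matrix (Fin 3) (Fin 3) ℂ) (d : Fin 3 → ℂ), P * Q = 1 ∧
      Q * K * P = Matrix.diagonal d ∧ d 0 ≠ d 1 ∧ d 0 ≠ d 2 := by
  have hdiag : ∀ (b : Module.Basis (Fin 3) ℂ (Fin 3 → ℂ)) (d : Fin 3 → ℂ),
      (∀ i, K *ᵥ b i = d i • b i) → ∃ P Q : Matrix (Fin 3) (Fin 3) ℂ, P * Q = 1 ∧
        Q * K * P = Matrix.diagonal d := by
    intro b d hd
    set P : Matrix (Fin 3) (Fin 3) ℂ := Matrix.of fun i j => b j i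
    have hP : IsUnit P := by
      rw [← Matrix.linearIndependent_cols_iff_isUnit]
      exact b.linearIndependent
    have hdet := (Matrix.isUnit_iff_isUnit_det P).1 hP
    refine ⟨P, P⁻¹, Matrix.mul_nonsing_inv P hdet, ?_⟩
    have hKP : K * P = P * Matrix.diagonal d := by
      ext i j
      rw [Matrix.mul_diagonal]
      have := congrFun (hd j) i
      simp only [Matrix.mulVec, dotProduct, Pi.smul_apply, smul_eq_mul] at this
      rw [Matrix.mul_apply]
      simp only [P, Matrix.of_apply]
      rw [this, mul_comm]
    rw [Matrix.mul_assoc, hKP, ← Matrix.mul_assoc, Matrix.nonsing_inv_mul P hdet, Matrix.one_mul]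
  obtain ⟨b, d, hd⟩ := h.exists_eigenbasis
  have hperm : ∀ σ : Equiv.Perm (Fin 3), d (σ 0) ≠ d (σ 1) → d (σ 0) ≠ d (σ 2) →
      ∃ (P Q : Matrix (Fin 3) (Fin 3) ℂ) (d : Fin 3 → ℂ), P * Q = 1 ∧
      Q * K * P = Matrix.diagonal d ∧ d 0 ≠ d 1 ∧ d 0 ≠ d 2 := by
    intro σ h1 h2
    obtain ⟨P, Q, h3, h4⟩ := hdiag (b.reindex σ.symm) (d ∘ σ) (fun i => by simp [hd])
    exact ⟨P, Q, d ∘ σ, h3, h4, h1, h2⟩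
  by_cases h01 : d 0 = d 1
  · by_cases h02 : d 0 = d 2
    · exfalso
      obtain ⟨P, Q, h3, h4⟩ := hdiag b d hd
      have hd' : Matrix.diagonal d = d 0 • (1 : Matrix (Fin 3) (Fin 3) ℂ) := by
        rw [Matrix.smul_one_eq_diagonal]
        congr 1
        ext i
        fin_cases i
        exacts [rfl, h01.symm, h02.symm]
      refine hK (d 0) ?_
      have h5 : P * (Q * K * P) * Q = K := by
        calc P * (Q * K * P) * Q = (P * Q) * K * (P * Q) := by noncomm_ring
          _ = K := by rw [h3]; simp
      rw [← h5, h4, hd', Matrix.mul_smul, Matrix.smul_mul, Matrix.mul_one, h3]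
    · exact hperm (Equiv.swap 0 2) (by simpa [Equiv.swap_apply_of_ne_of_ne, ← h01] using Ne.symm h02)
        (by simpa using Ne.symm h02)
  · by_cases h02 : d 0 = d 2
    · exact hperm (Equiv.swap 0 1) (by simpa using Ne.symm h01)
        (by simpa [Equiv.swap_apply_of_ne_of_ne, ← h02] using Ne.symm h01)
    · exact hperm 1 (by simpa using h01) (by simpa using h02)

/-- A `3 × 3` matrix is block diagonal, with blocks of sizes 1 and 2. -/
structure IsBlockDiag (X : Matrix (Fin 3) (Fin 3) ℂ) : Prop where
  h01 : X 0 1 = 0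
  h02 : X 0 2 = 0
  h10 : X 1 0 = 0
  h20 : X 2 0 = 0

lemma isBlockDiag_of_commute_diagonal {X : Matrix (Fin 3) (Fin 3) ℂ} {d : Fin 3 → ℂ}
    (h1 : d 0 ≠ d 1) (h2 : d 0 ≠ d 2) (h : Commute X (Matrix.diagonal d)) : X.IsBlockDiag := by
  have key : ∀ i j, d i ≠ d j → X i j = 0 := by
    intro i j hij
    have := congrFun (congrFun h.eq i) j
    rw [Matrix.mul_diagonal, Matrix.diagonal_mul] at this
    have h3 : (d i - d j) * X i j = 0 := by linear_combination -this
    exact (mul_eq_zero.1 h3).resolve_left (sub_ne_zero.2 hij)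
  exact ⟨key _ _ h1, key _ _ h2, key _ _ h1.symm, key _ _ h2.symm⟩

/-- Two block diagonal matrices that commute with a third one whose block of size 2 is not scalar
commute with each other. -/
lemma IsBlockDiag.commute_of_commute {X Y M : Matrix (Fin 3) (Fin 3) ℂ} (hX : X.IsBlockDiag)
    (hY : Y.IsBlockDiag) (hM : M.IsBlockDiag) (hXM : Commute X M) (hYM : Commute Y M)
    (h : ¬ (M 1 2 = 0 ∧ M 2 1 = 0 ∧ M 1 1 = M 2 2)) : Commute X Y := by
  -- Commutation means that the vectors (X₁₂, X₂₁, X₁₁ - X₂₂) and its analogue for Y are parallel;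
  -- two vectors parallel to the same nonzero vector are parallel.
  have ent : ∀ {Y : Matrix (Fin 3) (Fin 3) ℂ}, Y.IsBlockDiag → ∀ {X : Matrix (Fin 3) (Fin 3) ℂ},
      X.IsBlockDiag → (X * Y = Y * X ↔ X 1 2 * Y 2 1 = Y 1 2 * X 2 1 ∧
        X 1 2 * (Y 1 1 - Y 2 2) = Y 1 2 * (X 1 1 - X 2 2) ∧
        X 2 1 * (Y 1 1 - Y 2 2) = Y 2 1 * (X 1 1 - X 2 2)) := by
    intro Y hY X hX
    constructor
    · intro h
      have e := fun i j => congrFun (congrFun h i) j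
      have e11 := e 1 1
      have e12 := e 1 2
      have e21 := e 2 1
      simp only [Matrix.mul_apply, Fin.sum_univ_three, hX.h10, hX.h20, hY.h10, hY.h20] at e11 e12 e21
      refine ⟨by linear_combination e11, by linear_combination -e12, by linear_combination e21⟩
    · rintro ⟨e1, e2, e3⟩
      ext i j
      simp only [Matrix.mul_apply, Fin.sum_univ_three]
      fin_cases i <;> fin_cases j <;>
        simp [hX.h01, hX.h02, hX.h10, hX.h20, hY.h01, hY.h02, hY.h10, hY.h20]
      · ring
      · linear_combination e1
      · linear_combination -e2
      · linear_combination e3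
      · linear_combination -e1
  obtain ⟨x1, x2, x3⟩ := (ent hM hX).1 hXM.eq
  obtain ⟨y1, y2, y3⟩ := (ent hM hY).1 hYM.eq
  refine (ent hY hX).2 ?_
  by_cases h12 : M 1 2 = 0
  · by_cases h21 : M 2 1 = 0
    · have h11 : M 1 1 - M 2 2 ≠ 0 := fun hh => h ⟨h12, h21, sub_eq_zero.1 hh⟩
      rw [h12, zero_mul] at x2 y2
      rw [h21, zero_mul] at x3 y3
      rw [(mul_eq_zero.1 x2).resolve_right h11, (mul_eq_zero.1 x3).resolve_right h11,
        (mul_eq_zero.1 y2).resolve_right h11, (mul_eq_zero.1 y3).resolve_right h11]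
      simp
    · refine ⟨mul_left_cancel₀ h21 ?_, mul_left_cancel₀ h21 ?_, mul_left_cancel₀ h21 ?_⟩
      · linear_combination Y 2 1 * x1 - X 2 1 * y1
      · linear_combination (Y 1 1 - Y 2 2) * x1 - (X 1 1 - X 2 2) * y1
          + (X 2 1 * (Y 1 1 - Y 2 2) - Y 2 1 * (X 1 1 - X 2 2)) * h12
      · linear_combination Y 2 1 * x3 - X 2 1 * y3
  · have g1 : X 1 2 * Y 2 1 = Y 1 2 * X 2 1 :=
      mul_left_cancel₀ h12 (by linear_combination Y 1 2 * x1 - X 1 2 * y1)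
    refine ⟨g1, mul_left_cancel₀ h12 ?_, mul_left_cancel₀ h12 ?_⟩
    · linear_combination Y 1 2 * x2 - X 1 2 * y2
    · linear_combination Y 2 1 * x2 - X 2 1 * y2 - (M 1 1 - M 2 2) * g1

end Matrix

namespace Matrix

/-- Property L passes to the block of size 2 of a pair of block diagonal matrices. -/
lemma IsBlockDiag.exists_of_hasPropertyL {A B : Matrix (Fin 3) (Fin 3) ℂ} (hA : A.IsBlockDiag)
    (hB : B.IsBlockDiag) (hL : HasPropertyL A B) : ∃ l m l' m' : ℂ,
      A 1 1 + A 2 2 = l + l' ∧ B 1 1 + B 2 2 = m + m' ∧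
      A 1 1 * A 2 2 - A 1 2 * A 2 1 = l * l' ∧ B 1 1 * B 2 2 - B 1 2 * B 2 1 = m * m' ∧
      A 1 1 * B 2 2 + B 1 1 * A 2 2 - A 1 2 * B 2 1 - B 1 2 * A 2 1 = l * m' + m * l' := by
  obtain ⟨lam, mu, h⟩ := (hasPropertyL_iff A B).1 hL
  have hdet : ∀ x y z : ℂ, (z - (x * A 0 0 + y * B 0 0)) *
      ((z - (x * A 1 1 + y * B 1 1)) * (z - (x * A 2 2 + y * B 2 2))
        - (x * A 1 2 + y * B 1 2) * (x * A 2 1 + y * B 2 1))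
      = ∏ i, (z - (x * lam i + y * mu i)) := by
    intro x y z
    rw [← h, Matrix.det_fin_three]
    simp [Matrix.scalar_apply, hA.h01, hA.h02, hA.h10, hA.h20, hB.h01, hB.h02, hB.h10, hB.h20]
    ring
  -- The block of size 1 contributes a root for every y, so a product of affine polynomials in y is
  -- zero and one of them is.
  have hi : ∃ i, lam i = A 0 0 ∧ mu i = B 0 0 := by
    have h0 : ∏ i, (Polynomial.C (A 0 0 - lam i) + Polynomial.X * Polynomial.C (B 0 0 - mu i)) = 0 := by
      refine Polynomial.funext fun y => ?_
      have := hdet 1 y (A 0 0 + y * B 0 0)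
      rw [one_mul, sub_self, zero_mul] at this
      rw [Polynomial.eval_prod, Polynomial.eval_zero, this]
      refine Finset.prod_congr rfl fun i _ => ?_
      simp
      ring
    obtain ⟨i, -, hi⟩ := Finset.prod_eq_zero_iff.1 h0
    have e := fun n => congrArg (fun q : Polynomial ℂ => q.coeff n) hi
    have e0 := e 0
    have e1 := e 1
    simp [Polynomial.coeff_C, Polynomial.coeff_X] at e0 e1
    exact ⟨i, (sub_eq_zero.1 e0).symm, (sub_eq_zero.1 e1).symm⟩
  have hrest : ∀ l m l' m' : ℂ, (∀ x y z : ℂ, (z - (x * A 0 0 + y * B 0 0)) *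
      ((z - (x * A 1 1 + y * B 1 1)) * (z - (x * A 2 2 + y * B 2 2))
        - (x * A 1 2 + y * B 1 2) * (x * A 2 1 + y * B 2 1))
      = (z - (x * A 0 0 + y * B 0 0)) * ((z - (x * l + y * m)) * (z - (x * l' + y * m')))) →
      ∃ l m l' m' : ℂ,
      A 1 1 + A 2 2 = l + l' ∧ B 1 1 + B 2 2 = m + m' ∧
      A 1 1 * A 2 2 - A 1 2 * A 2 1 = l * l' ∧ B 1 1 * B 2 2 - B 1 2 * B 2 1 = m * m' ∧
      A 1 1 * B 2 2 + B 1 1 * A 2 2 - A 1 2 * B 2 1 - B 1 2 * A 2 1 = l * m' + m * l' := by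
    intro l m l' m' hq
    have hs : ∀ x y : ℂ, x * (A 1 1 + A 2 2) + y * (B 1 1 + B 2 2) = x * (l + l') + y * (m + m') := by
      intro x y
      -- Here and in the next line the common linear factor equals 1 and 2, so it can be cancelled.
      have h1 := hq x y (x * A 0 0 + y * B 0 0 + 1)
      have h2 := hq x y (x * A 0 0 + y * B 0 0 + 2)
      linear_combination h1 - (1 / 2) * h2
    have hp : ∀ x y : ℂ, (x * A 1 1 + y * B 1 1) * (x * A 2 2 + y * B 2 2)
        - (x * A 1 2 + y * B 1 2) * (x * A 2 1 + y * B 2 1)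
        = (x * l + y * m) * (x * l' + y * m') := by
      intro x y
      have h1 := hq x y (x * A 0 0 + y * B 0 0 + 1)
      linear_combination h1 + (x * A 0 0 + y * B 0 0 + 1) * hs x y
    refine ⟨l, m, l', m', by simpa using hs 1 0, by simpa using hs 0 1, by simpa using hp 1 0,
      by simpa using hp 0 1, ?_⟩
    linear_combination hp 1 1 - hp 1 0 - hp 0 1
  simp only [Fin.prod_univ_three] at hdet
  obtain ⟨i, h1, h2⟩ := hi
  fin_cases i
  · exact hrest (lam 1) (mu 1) (lam 2) (mu 2) fun x y z => by
      rw [hdet, ← h1, ← h2]; simp only [Fin.zero_eta]; ring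
  · exact hrest (lam 0) (mu 0) (lam 2) (mu 2) fun x y z => by
      rw [hdet, ← h1, ← h2]; simp only [Fin.mk_one]; ring
  · exact hrest (lam 0) (mu 0) (lam 1) (mu 1) fun x y z => by
      rw [hdet, ← h1, ← h2]; simp only [Fin.reduceFinMk]; ring

/-- On a subspace where `exp A` is the scalar `e`, the eigenvalues of `A` exponentiate to `e`. -/
lemma exp_eq_of_exp_mul_eq_smul {n m : Type*} [Fintype n] [DecidableEq n]
    {A : Matrix n n ℂ} {W : Matrix n m ℂ} {e l l' : ℂ} (hW : W ≠ 0)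
    (hE : NormedSpace.exp A * W = e • W)
    (h : (A - l • (1 : Matrix n n ℂ)) * ((A - l' • (1 : Matrix n n ℂ)) * W) = 0)
    (h' : (A - l' • (1 : Matrix n n ℂ)) * W = 0 → l = l') : Complex.exp l = e := by
  by_cases hY : (A - l' • (1 : Matrix n n ℂ)) * W = 0
  · have := exp_mul_of_sub_mul_eq_zero hY
    rw [hE] at this
    rw [h' hY]
    exact (smul_left_injective ℂ hW this).symm
  · have h1 := exp_mul_of_sub_mul_eq_zero h
    have hc : Commute (NormedSpace.exp A) (A - l' • (1 : Matrix n n ℂ)) :=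
      ((Commute.refl A).exp_left).sub_right ((Commute.one_right _).smul_right _)
    rw [← Matrix.mul_assoc, hc.eq, Matrix.mul_assoc, hE, Matrix.mul_smul] at h1
    exact (smul_left_injective ℂ hY h1).symm

/-- The semisimple block diagonal case. -/
lemma IsBlockDiag.eventually_exp {A B : Matrix (Fin 3) (Fin 3) ℂ} (hAd : A.IsBlockDiag)
    (hBd : B.IsBlockDiag) (hEd : (NormedSpace.exp A).IsBlockDiag)
    (hFd : (NormedSpace.exp B).IsBlockDiag) (hA : A.IsSemisimple)
    (hBE : Commute B (NormedSpace.exp A)) (hAF : Commute A (NormedSpace.exp B))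
    (hL : HasPropertyL A B) :
    ∀ᶠ t : ℕ in atTop, NormedSpace.exp ((t : ℂ) • A + B)
      = NormedSpace.exp ((t : ℂ) • A) * NormedSpace.exp B := by
  by_cases hAB : Commute A B
  · exact Eventually.of_forall fun t => exp_natCast_smul_add_of_commute hAB t
  -- The centralizer of a non-scalar 2 × 2 matrix is commutative, so non-commuting A and B force
  -- scalar blocks in both exponentials.
  have hEs := not_not.1 fun hh => hAB
    (hAd.commute_of_commute hBd hEd ((Commute.refl A).exp_right) hBE hh)
  have hFs := not_not.1 fun hh => hAB
    (hAd.commute_of_commute hBd hFd hAF ((Commute.refl B).exp_right) hh)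
  obtain ⟨l, m, l', m', q1, q2, q3, q4, q5⟩ := hAd.exists_of_hasPropertyL hBd hL
  set W0 : Matrix (Fin 3) (Fin 3) ℂ := Matrix.diagonal ![1, 0, 0] with hW0
  set W : Matrix (Fin 3) (Fin 3) ℂ := Matrix.diagonal ![0, 1, 1] with hW
  have hWW : W0 + W = 1 := by
    ext i j
    fin_cases i <;> fin_cases j <;> simp [hW0, hW]
  have hWne : W ≠ 0 := fun hh => by
    have := congrFun (congrFun hh 1) 1
    simp [hW] at this
  have hmulW0 : ∀ {X : Matrix (Fin 3) (Fin 3) ℂ}, X.IsBlockDiag → X * W0 = X 0 0 • W0 := by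
    intro X hX
    ext i j
    rw [hW0, Matrix.mul_diagonal, Matrix.smul_apply]
    fin_cases i <;> fin_cases j <;> simp [hX.h10, hX.h20]
  have hmulW : ∀ {X : Matrix (Fin 3) (Fin 3) ℂ}, X.IsBlockDiag →
      X 1 2 = 0 ∧ X 2 1 = 0 ∧ X 1 1 = X 2 2 → X * W = X 1 1 • W := by
    intro X hX h
    ext i j
    rw [hW, Matrix.mul_diagonal, Matrix.smul_apply]
    fin_cases i <;> fin_cases j <;> simp [hX.h01, hX.h02, h.1, h.2.1, ← h.2.2]
  have hquad : ∀ {X : Matrix (Fin 3) (Fin 3) ℂ}, X.IsBlockDiag → ∀ {a b : ℂ},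
      X 1 1 + X 2 2 = a + b → X 1 1 * X 2 2 - X 1 2 * X 2 1 = a * b →
      (X - a • (1 : Matrix (Fin 3) (Fin 3) ℂ)) * ((X - b • (1 : Matrix (Fin 3) (Fin 3) ℂ)) * W)
        = 0 := by
    intro X hX a b h1 h2
    rw [← Matrix.mul_assoc]
    ext i j
    rw [hW, Matrix.mul_diagonal, Matrix.mul_apply, Fin.sum_univ_three]
    fin_cases i <;> fin_cases j <;> simp [hX.h01, hX.h02, hX.h10, hX.h20]
    · linear_combination X 1 1 * h1 - h2
    · linear_combination X 1 2 * h1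
    · linear_combination X 2 1 * h1
    · linear_combination X 2 2 * h1 - h2
  have hlin : ∀ {X : Matrix (Fin 3) (Fin 3) ℂ} {a : ℂ},
      (X - a • (1 : Matrix (Fin 3) (Fin 3) ℂ)) * W = 0 →
      X 1 1 = a ∧ X 2 2 = a ∧ X 1 2 = 0 ∧ X 2 1 = 0 := by
    intro X a h
    have ent := fun i j => congrFun (congrFun h i) j
    have e11 := ent 1 1
    have e22 := ent 2 2
    have e12 := ent 1 2
    have e21 := ent 2 1
    simp [hW, Matrix.mul_diagonal] at e11 e22 e12 e21
    exact ⟨sub_eq_zero.1 e11, sub_eq_zero.1 e22, e12, e21⟩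
  have hEW := hmulW hEd hEs
  have hFW := hmulW hFd hFs
  set e := NormedSpace.exp A 1 1
  set f := NormedSpace.exp B 1 1
  have hl : Complex.exp l = e := exp_eq_of_exp_mul_eq_smul hWne hEW (hquad hAd q1 q3) fun h => by
    obtain ⟨h1, h2, -, -⟩ := hlin h
    linear_combination h1 + h2 - q1
  have hl' : Complex.exp l' = e := exp_eq_of_exp_mul_eq_smul hWne hEW
    (hquad hAd (q1.trans (add_comm _ _)) (q3.trans (mul_comm _ _))) fun h => by
    obtain ⟨h1, h2, -, -⟩ := hlin h
    linear_combination h1 + h2 - q1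
  have hm : Complex.exp m = f := exp_eq_of_exp_mul_eq_smul hWne hFW (hquad hBd q2 q4) fun h => by
    obtain ⟨h1, h2, -, -⟩ := hlin h
    linear_combination h1 + h2 - q2
  have hm' : Complex.exp m' = f := exp_eq_of_exp_mul_eq_smul hWne hFW
    (hquad hBd (q2.trans (add_comm _ _)) (q4.trans (mul_comm _ _))) fun h => by
    obtain ⟨h1, h2, -, -⟩ := hlin h
    linear_combination h1 + h2 - q2
  -- A double eigenvalue would make the semisimple A scalar on the block, hence commuting with B.
  have hll : ¬ l = l' := by
    intro hll
    refine hAB ?_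
    have h0 := hA.aeval_mul_eq_zero (W := W) (Polynomial.X - Polynomial.C l) 2 two_ne_zero (by
      rw [pow_two, aeval_sub_mul_sub, Matrix.mul_assoc]
      nth_rewrite 2 [hll]
      exact hquad hAd q1 q3)
    rw [map_sub, Polynomial.aeval_X, Polynomial.aeval_C, Algebra.algebraMap_eq_smul_one] at h0
    obtain ⟨h1, h2, h3, h4⟩ := hlin h0
    ext i j
    simp only [Matrix.mul_apply, Fin.sum_univ_three]
    fin_cases i <;> fin_cases j <;>
      simp [hAd.h01, hAd.h02, hAd.h10, hAd.h20, hBd.h01, hBd.h02, hBd.h10, hBd.h20, h1, h2, h3, h4,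
        mul_comm]
  filter_upwards [eventually_linear_ne_zero (sub_ne_zero.2 hll) (m - m')] with t ht
  have hne : (t : ℂ) * l + m ≠ t * l' + m' := fun he => ht (by linear_combination he)
  have hZd : ((t : ℂ) • A + B).IsBlockDiag :=
    ⟨by simp [hAd.h01, hBd.h01], by simp [hAd.h02, hBd.h02], by simp [hAd.h10, hBd.h10],
      by simp [hAd.h20, hBd.h20]⟩
  have hexp : ∀ {a b : ℂ}, Complex.exp a = e → Complex.exp b = f →
      Complex.exp (t * a + b) = e ^ t * f := fun ha hb => by
    rw [Complex.exp_add, Complex.exp_nat_mul, ha, hb]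
  have hpow : ∀ {X : Matrix (Fin 3) (Fin 3) ℂ} {c : ℂ}, NormedSpace.exp A * X = c • X →
      NormedSpace.exp A ^ t * X = c ^ t • X := by
    intro X c h
    clear ht hne hZd hexp
    induction t with
    | zero => simp
    | succ k ih => rw [pow_succ, Matrix.mul_assoc, h, Matrix.mul_smul, ih, smul_smul, pow_succ,
        mul_comm]
  have hZW := exp_mul_of_two_eigenvalues hne (hquad hZd
    (by simp; linear_combination (t : ℂ) * q1 + q2)
    (by simp; linear_combination (t : ℂ) ^ 2 * q3 + q4 + (t : ℂ) * q5)) (hexp hl hm) (hexp hl' hm')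
  have hZ0 := exp_mul_of_mul_eq_smul (hmulW0 hZd)
  have hA0 := exp_mul_of_mul_eq_smul (hmulW0 hAd)
  have hB0 := exp_mul_of_mul_eq_smul (hmulW0 hBd)
  rw [exp_natCast_smul]
  calc NormedSpace.exp ((t : ℂ) • A + B)
      = NormedSpace.exp ((t : ℂ) • A + B) * W0 + NormedSpace.exp ((t : ℂ) • A + B) * W := by
        rw [← Matrix.mul_add, hWW, Matrix.mul_one]
    _ = (NormedSpace.exp A ^ t * NormedSpace.exp B) * W0
        + (NormedSpace.exp A ^ t * NormedSpace.exp B) * W := by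
        rw [hZ0, hZW, Matrix.mul_assoc, Matrix.mul_assoc, hB0, hFW, Matrix.mul_smul,
          Matrix.mul_smul, hpow hA0, hpow hEW, smul_smul, smul_smul]
        congr 2
        · simp only [Matrix.add_apply, Matrix.smul_apply, smul_eq_mul]
          rw [Complex.exp_add, Complex.exp_nat_mul, mul_comm]
        · rw [mul_comm]
    _ = NormedSpace.exp A ^ t * NormedSpace.exp B := by
        rw [← Matrix.mul_add, hWW, Matrix.mul_one]

lemma det_scalar_sub_conj {n : Type*} [Fintype n] [DecidableEq n] {P Q : Matrix n n ℂ}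
    (h : P * Q = 1) (X : Matrix n n ℂ) (z : ℂ) :
    (Matrix.scalar n z - Q * X * P).det = (Matrix.scalar n z - X).det := by
  have h' : Q * P = 1 := mul_eq_one_comm.1 h
  have e : Matrix.scalar n z - Q * X * P = Q * (Matrix.scalar n z - X) * P := by
    rw [Matrix.mul_sub, Matrix.sub_mul, ← (Matrix.scalar_commute z (fun _ => mul_comm _ _) Q).eq,
      Matrix.mul_assoc _ Q P, h', Matrix.mul_one]
  rw [e, Matrix.det_mul_right_comm, h', Matrix.one_mul]

end Matrix

/-! ### Conjugation and the general semisimple case -/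

namespace Matrix

section
variable {n : Type*} [Fintype n] [DecidableEq n]

lemma exp_conj_of_mul_eq_one {P Q : Matrix n n ℂ} (h : P * Q = 1) (X : Matrix n n ℂ) :
    NormedSpace.exp (Q * X * P) = Q * NormedSpace.exp X * P := by
  rw [← Matrix.inv_eq_right_inv h]
  exact Matrix.exp_conj' P X (IsUnit.of_mul_eq_one Q h)

lemma conj_mul_conj {P Q : Matrix n n ℂ} (h : P * Q = 1) (X Y : Matrix n n ℂ) :
    (Q * X * P) * (Q * Y * P) = Q * (X * Y) * P := by
  calc (Q * X * P) * (Q * Y * P) = Q * X * (P * Q) * Y * P := by noncomm_ring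
    _ = _ := by rw [h]; noncomm_ring

lemma eq_of_conj_eq {P Q : Matrix n n ℂ} (h : P * Q = 1) {X Y : Matrix n n ℂ}
    (hXY : Q * X * P = Q * Y * P) : X = Y := by
  have key : ∀ X, P * (Q * X * P) * Q = X := fun X => by
    calc P * (Q * X * P) * Q = (P * Q) * X * (P * Q) := by noncomm_ring
      _ = X := by rw [h]; simp
  rw [← key X, hXY, key]

lemma _root_.Commute.matrix_conj {P Q X Y : Matrix n n ℂ} (hXY : Commute X Y) (h : P * Q = 1) :
    Commute (Q * X * P) (Q * Y * P) := by
  rw [Commute, SemiconjBy, conj_mul_conj h, conj_mul_conj h, hXY.eq]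

/-- Adding a commuting nilpotent matrix does not change the characteristic polynomial. -/
lemma charpoly_add_of_isNilpotent {S N : Matrix n n ℂ} (hc : Commute S N) (hN : IsNilpotent N) :
    (S + N).charpoly = S.charpoly := by
  -- The extra factor leaves only the z for which z - S is invertible, where z - S - N is z - S
  -- times a unipotent matrix.
  have h0 : ((S + N).charpoly - S.charpoly) * S.charpoly = 0 := by
    refine Polynomial.funext fun z => ?_
    rw [Polynomial.eval_mul, Polynomial.eval_sub, Polynomial.eval_zero]
    by_cases hz : S.charpoly.eval z = 0
    · rw [hz, mul_zero]
    rw [Matrix.eval_charpoly] at hz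
    obtain ⟨u, hu⟩ := (Matrix.isUnit_iff_isUnit_det _).2 (isUnit_iff_ne_zero.2 hz)
    have hcu : Commute (u : Matrix n n ℂ) N := by
      rw [hu]
      exact (Matrix.scalar_commute z (fun _ => mul_comm _ _) N).sub_left hc
    have hnil : IsNilpotent ((↑u⁻¹ : Matrix n n ℂ) * N) :=
      Commute.isNilpotent_mul_left hcu.units_inv_left hN
    have hdet : (1 - (↑u⁻¹ : Matrix n n ℂ) * N).det = 1 := by
      have := Matrix.eval_charpoly ((↑u⁻¹ : Matrix n n ℂ) * N) 1
      rw [hnil.matrix_charpoly_eq] at this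
      simpa using this.symm
    have hfac : Matrix.scalar n z - (S + N) = u * (1 - (↑u⁻¹ : Matrix n n ℂ) * N) := by
      rw [mul_sub, mul_one, Units.mul_inv_cancel_left, hu]
      abel
    rw [Matrix.eval_charpoly, Matrix.eval_charpoly, hfac, Matrix.det_mul, hdet, mul_one, hu,
      sub_self, zero_mul]
  exact sub_eq_zero.1 ((mul_eq_zero.1 h0).resolve_right S.charpoly_monic.ne_zero)

end

/-- In a basis diagonalizing K with a simple first eigenvalue, everything commuting with K is block
diagonal, and all hypotheses are invariant under conjugation. -/
lemma eventually_exp_of_commute_nonscalar {A B K : Matrix (Fin 3) (Fin 3) ℂ}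
    (hA : A.IsSemisimple) (hK : K.IsSemisimple)
    (hKs : ∀ c : ℂ, K ≠ c • (1 : Matrix (Fin 3) (Fin 3) ℂ)) (hAK : Commute A K)
    (hBK : Commute B K) (hBE : Commute B (NormedSpace.exp A))
    (hAF : Commute A (NormedSpace.exp B)) (hL : HasPropertyL A B) :
    ∀ᶠ t : ℕ in atTop, NormedSpace.exp ((t : ℂ) • A + B)
      = NormedSpace.exp ((t : ℂ) • A) * NormedSpace.exp B := by
  obtain ⟨P, Q, d, hPQ, hd, h1, h2⟩ := hK.exists_diagonalization hKs
  have hblock : ∀ {X : Matrix (Fin 3) (Fin 3) ℂ}, Commute X K → (Q * X * P).IsBlockDiag :=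
    fun hX => isBlockDiag_of_commute_diagonal h1 h2 (hd ▸ hX.matrix_conj hPQ)
  have hlin : ∀ x y : ℂ, x • (Q * A * P) + y • (Q * B * P) = Q * (x • A + y • B) * P := by
    intro x y
    simp [Matrix.mul_add, Matrix.add_mul]
  have hL' : HasPropertyL (Q * A * P) (Q * B * P) := by
    rw [hasPropertyL_iff] at hL ⊢
    obtain ⟨lam, mu, h⟩ := hL
    exact ⟨lam, mu, fun x y z => by rw [hlin, det_scalar_sub_conj hPQ, h]⟩
  have hE := exp_conj_of_mul_eq_one hPQ A
  have hF := exp_conj_of_mul_eq_one hPQ B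
  have := IsBlockDiag.eventually_exp (hblock hAK) (hblock hBK) (hE ▸ hblock hAK.exp_left)
    (hF ▸ hblock hBK.exp_left) (hA.conj hPQ) (hE ▸ hBE.matrix_conj hPQ)
    (hF ▸ hAF.matrix_conj hPQ) hL'
  filter_upwards [this] with t ht
  refine eq_of_conj_eq hPQ ?_
  have e1 := hlin t 1
  have e2 := hlin t 0
  simp only [one_smul, zero_smul, add_zero] at e1 e2
  rw [e1, e2, hF, exp_conj_of_mul_eq_one hPQ, exp_conj_of_mul_eq_one hPQ, conj_mul_conj hPQ] at ht
  exact ht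

/-- The semisimple case. -/
lemma eventually_exp_of_isSemisimple {A B : Matrix (Fin 3) (Fin 3) ℂ}
    (hA : A.IsSemisimple) (hB : B.IsSemisimple) (hC : (A + B).IsSemisimple)
    (hc : Commute (NormedSpace.exp A) (NormedSpace.exp B))
    (h : NormedSpace.exp (A + B) = NormedSpace.exp A * NormedSpace.exp B)
    (hL : HasPropertyL A B) :
    ∀ᶠ t : ℕ in atTop, NormedSpace.exp ((t : ℂ) • A + B)
      = NormedSpace.exp ((t : ℂ) • A) * NormedSpace.exp B := by
  obtain ⟨hBE, hAF⟩ := commute_exp_of_exp_add hA hc h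
  by_cases hE : ∃ e : ℂ, NormedSpace.exp A = e • (1 : Matrix (Fin 3) (Fin 3) ℂ)
  · by_cases hF : ∃ f : ℂ, NormedSpace.exp B = f • (1 : Matrix (Fin 3) (Fin 3) ℂ)
    · obtain ⟨e, hE⟩ := hE
      obtain ⟨f, hF⟩ := hF
      exact eventually_exp_of_scalar hA hB hC hE hF hL
    · push Not at hF
      exact eventually_exp_of_commute_nonscalar hA hB.exp hF hAF
        ((Commute.refl B).exp_right) hBE hAF hL
  · push Not at hE
    exact eventually_exp_of_commute_nonscalar hA hA.exp hE ((Commute.refl A).exp_right) hBE hBE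
      hAF hL

end Matrix

/-! ### Removal of the nilpotent parts and conclusion -/

open Matrix in
/-- If `exp (A + B) = exp A * exp B = exp B * exp A` and `(A, B)` has property L, then
`exp (t A + B) = exp (t A) exp B` for all large integers `t`. -/
theorem HasPropertyL.eventually_exp {A B : Matrix (Fin 3) (Fin 3) ℂ} (hL : HasPropertyL A B)
    (hc : Commute (NormedSpace.exp A) (NormedSpace.exp B))
    (h : NormedSpace.exp (A + B) = NormedSpace.exp A * NormedSpace.exp B) :
    ∀ᶠ t : ℕ in atTop, NormedSpace.exp ((t : ℂ) • A + B)
      = NormedSpace.exp ((t : ℂ) • A) * NormedSpace.exp B := by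
  have cube : ∀ {N : Matrix (Fin 3) (Fin 3) ℂ}, IsNilpotent N → N ^ 3 = 0 := fun h => by
    simpa using h.matrix_pow_card_eq_zero
  obtain ⟨S, N, rfl, hSN, hS, hN, -⟩ := exists_jordanChevalley A
  obtain ⟨T, M, rfl, hTM, hT, hM, -⟩ := exists_jordanChevalley B
  obtain ⟨R, L, hRL, hRLc, hR, hLn, -⟩ := exists_jordanChevalley (S + N + (T + M))
  -- Splitting the two commuting exponentials gives commutation among exp S, N on one side and exp
  -- T, M on the other; S and T themselves need not commute.
  obtain ⟨k1, k2⟩ := commute_of_commute_exp hS (cube hN) hSN hc.symm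
  obtain ⟨cST, cSM⟩ := commute_of_commute_exp hT (cube hM) hTM k1.symm
  obtain ⟨cNT, cNM⟩ := commute_of_commute_exp hT (cube hM) hTM k2.symm
  have hNM : IsNilpotent (N + M) := cNM.isNilpotent_add hN hM
  have hprod : NormedSpace.exp (S + N) * NormedSpace.exp (T + M)
      = (NormedSpace.exp S * NormedSpace.exp T) * NormedSpace.exp (N + M) := by
    rw [Matrix.exp_add_of_commute _ _ hSN, Matrix.exp_add_of_commute _ _ hTM,
      Matrix.exp_add_of_commute _ _ cNM, mul_assoc, ← mul_assoc (NormedSpace.exp N),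
      cNT.exp_left.eq, mul_assoc, mul_assoc]
  rw [hprod, hRL, Matrix.exp_add_of_commute _ _ hRLc] at h
  -- Both sides of h are multiplicative Jordan-Chevalley decompositions of the same matrix.
  obtain ⟨e1, e2⟩ := eq_of_mul_exp_eq_mul_exp hR.exp (Matrix.isUnit_exp R) (cube hLn)
    hRLc.exp_left (hS.exp.mul hT.exp cST) (cube hNM)
    ((hSN.exp_left.add_right cSM).mul_left (cNT.symm.add_right hTM.exp_left)) h
  have e3 : R = S + T := by
    have : R = S + N + (T + M) - L := by rw [hRL]; abel
    rw [this, e2]; abel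
  subst e2 e3
  -- Since [S, N], [T, M] and [S + T, N + M] vanish, [S, M] + [T, N] = 0, and this is the
  -- coefficient of xy in the commutator.
  have hpencil : ∀ x y : ℂ, Commute (x • S + y • T) (x • N + y • M) := by
    intro x y
    have h1 := hSN.eq
    have h2 := hTM.eq
    have h3 := hRLc.eq
    simp only [mul_add, add_mul] at h3
    rw [Commute, SemiconjBy]
    simp only [mul_add, add_mul, Matrix.smul_mul, Matrix.mul_smul]
    linear_combination (norm := module) (x ^ 2 - x * y) • h1 + (y ^ 2 - x * y) • h2 + (x * y) • h3
  have hpnil : ∀ x y : ℂ, IsNilpotent (x • N + y • M) := fun x y =>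
    ((cNM.smul_left x).smul_right y).isNilpotent_add (hN.smul x) (hM.smul y)
  have hsplit : ∀ x y : ℂ, x • (S + N) + y • (T + M) = (x • S + y • T) + (x • N + y • M) :=
    fun x y => by module
  have hLs : HasPropertyL S T := by
    rw [hasPropertyL_iff] at hL ⊢
    obtain ⟨lam, mu, hl⟩ := hL
    refine ⟨lam, mu, fun x y z => ?_⟩
    rw [← hl, hsplit, ← Matrix.eval_charpoly, ← Matrix.eval_charpoly,
      charpoly_add_of_isNilpotent (hpencil x y) (hpnil x y)]
  filter_upwards [eventually_exp_of_isSemisimple hS hT hR cST e1 hLs] with t ht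
  have hs1 := hsplit t 1
  have hp1 := hpencil t 1
  simp only [one_smul] at hs1 hp1
  rw [hs1, Matrix.exp_add_of_commute _ _ hp1, ht,
    Matrix.exp_add_of_commute _ _ (cNM.smul_left (t : ℂ)), smul_add,
    Matrix.exp_add_of_commute _ _ ((hSN.smul_left (t : ℂ)).smul_right (t : ℂ)),
    Matrix.exp_add_of_commute _ _ hTM]
  have hcomm : Commute (NormedSpace.exp ((t : ℂ) • N)) (NormedSpace.exp T) :=
    (cNT.smul_left (t : ℂ)).exp_left
  calc NormedSpace.exp ((t : ℂ) • S) * NormedSpace.exp T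
        * (NormedSpace.exp ((t : ℂ) • N) * NormedSpace.exp M)
      = NormedSpace.exp ((t : ℂ) • S) * (NormedSpace.exp T * NormedSpace.exp ((t : ℂ) • N))
        * NormedSpace.exp M := by noncomm_ring
    _ = NormedSpace.exp ((t : ℂ) • S) * (NormedSpace.exp ((t : ℂ) • N) * NormedSpace.exp T)
        * NormedSpace.exp M := by rw [hcomm.eq]
    _ = _ := by noncomm_ring

theorem mainTheorem1 (A B : Matrix (Fin 3) (Fin 3) ℂ) :
    (∃ U : Finset ℕ, (∀ u ∈ U, 2 ≤ u) ∧
      ∀ t : ℕ, 1 ≤ t → t ∉ U →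
        NormedSpace.exp ((t : ℂ) • A + B)
            = NormedSpace.exp ((t : ℂ) • A) * NormedSpace.exp B ∧
          NormedSpace.exp ((t : ℂ) • A) * NormedSpace.exp B
            = NormedSpace.exp B * NormedSpace.exp ((t : ℂ) • A)) ↔
    ((NormedSpace.exp (A + B) = NormedSpace.exp A * NormedSpace.exp B ∧
        NormedSpace.exp A * NormedSpace.exp B = NormedSpace.exp B * NormedSpace.exp A) ∧
      HasPropertyL A B) := by
  constructor
  · rintro ⟨U, hU, h⟩
    -- The exceptional set avoids 1, so t = 1 supplies the relation for A + B.
    have h1 := h 1 le_rfl (fun hh => absurd (hU 1 hh) (by norm_num))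
    rw [Nat.cast_one, one_smul] at h1
    refine ⟨h1, hasPropertyL_of_eventually h1.2 ?_⟩
    filter_upwards [eventually_gt_atTop (U.sup id), eventually_ge_atTop 1] with t ht ht1
    exact (h t ht1 fun hh => absurd (Finset.le_sup (f := id) hh) (not_le.2 ht)).1
  · rintro ⟨⟨h1, h2⟩, hL⟩
    obtain ⟨T, hT⟩ := eventually_atTop.1 (hL.eventually_exp h2 h1)
    refine ⟨Finset.Ico 2 T, fun u hu => (Finset.mem_Ico.1 hu).1, fun t ht htU => ⟨?_, ?_⟩⟩
    · rcases Nat.lt_or_ge t 2 with h | h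
      · obtain rfl : t = 1 := by omega
        simpa using h1
      · exact hT t (not_lt.1 fun hlt => htU (Finset.mem_Ico.2 ⟨h, hlt⟩))
    · have h3 : Commute (NormedSpace.exp A) (NormedSpace.exp B) := h2
      rw [Matrix.exp_natCast_smul]
      exact (h3.pow_left t).eq
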